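/- Let $\kappa$ be an uncountable strong limit cardinal. Vocabularies consist of finitary relation and function symbols, and structures are nonempty. **Logics.** A logic $\mathcal L$ assigns to each vocabulary $\tau$ a collection $\mathcal L(\tau)$ of sentences, with an isomorphism-invariant satisfaction relation between $\tau$-structures and these sentences (no closure properties are assumed). A class of $\tau$-structures is $\mathcal L$-definable if it is the class of models of some sentence in $\mathcal L(\tau)$. We write $\mathcal L\le\mathcal L'$ if, for every $\tau$, every $\mathcal L$-definable class of $\tau$-structures is $\mathcal L'$-definable. **The logics $L_{\kappa\kappa}$ and $L^{1,c}_\kappa$.** $L_{\lambda^+\lambda^+}$ is the usual infinitary logic with conjunctions of at most $\lambda$ formulas and quantification over blocks of at most $\lambda$ variables, and $L_{\kappa\kappa}=\bigcup_{\lambda<\kappa}L_{\lambda^+\lambda^+}$. $L_{\theta^+\omega}$ allows conjunctions of at most $\theta$ formulas and only finite quantifier blocks. $L^{1,c}_{\lambda^+,\le\theta}$ is the least class of formulas that contains $L_{\theta^+\omega}$ and is closed under negation, under $\forall x$ and $\exists x$ for single variables, under conjunctions and disjunctions of at most $\lambda$ formulas with at most $\theta$ free variables overall, and under the formation of $$\forall\bar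 x\bigvee_{f}\bigwedge_{n<\omega}\varphi_{f^{-1}(n)}(\bar x,\bar y)\qquad\text{and}\qquad\exists\bar x\bigwedge_{f}\bigvee_{n<\omega}\varphi_{f^{-1}(n)}(\bar x,\bar y),$$ where $\bar x,\bar y$ have length at most $\theta$, $f$ ranges over all functions from $\bar x$ to $\omega$, and for each $A\subseteq\bar x$ the free variables of $\varphi_A$ are among $A\cup\bar y$. Finally $L^{1,c}_\kappa=\bigcup\{L^{1,c}_{\lambda^+,\le\theta}:\theta,\lambda<\kappa,\ \mathrm{cf}(\theta)>\omega\}$. **The $\Delta$-operation.** A class $\mathcal K$ of $\tau$-structures is $\Sigma$ (or PC) in $\mathcal L$ if it is a relativized reduct of an $\mathcal L$-definable class: there are a vocabulary $\tau'\supseteq\tau$, a unary predicate $P\in\tau'\setminus\tau$ and a sentence $\chi\in\mathcal L(\tau')$ such that the members of $\mathcal K$ are, up to isomorphism, exactly the substructures with universe $P^M$ of the reducts $M\restriction\tau$, for those models $M$ of $\chi$ in which $P^M$ is nonempty and closed under the functions of $\tau$. $\mathcal K$ is $\Delta$ in $\mathcal L$ if both $\mathcal K$ and its complement are $\Sigma$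 in $\mathcal L$. $\Delta(\mathcal L)$ is the logic whose definable classes are exactly the classes that are $\Delta$ in $\mathcal L$. **Theorem.** Suppose that a logic $\mathcal L$ has the following properties. 1. $\mathcal L\le L_{\kappa\kappa}$. 2. $\mathcal L$ has a Union Lemma for $\prec_{\theta^+\theta^+}$-elementary chains, $\theta<\kappa$: for every sentence $\psi$ of $\mathcal L$ there is $\theta<\kappa$ such that, whenever $M_n\prec_{L_{\theta^+\theta^+}}M_{n+1}$ for all $n<\omega$ and $M_\omega=\bigcup_{n<\omega}M_n$, we have $M_n\models\psi$ if and only if $M_\omega\models\psi$, for all $n<\omega$. 3. For every cardinal $\mu<\kappa$, $\mathcal L$ contains the covering sentence $\Theta_\mu$; that is, the class of all structures $(M,R)$ with $R$ binary such that $|R(a,\cdot)|\le\mu$ for all $a\in M$, and such that every $X\subseteq M$ with $|X|\le\mu$ satisfies $X\subseteq\bigcup_{n<\omega}R(a_n,\cdot)$ for some $a_0,a_1,\ldots\in M$, is $\mathcal L$-definable. Then $\mathcal L\le\Delta(L^{1,c}_\kappa)$. That is, for every sentence of $\mathcal L$, both its class of models and the complement of this class are PC in $L^{1,c}_\kappa$.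 -/

import Mathlib

open Cardinal
open scoped FirstOrder

universe u w w'

namespace InfLogic

/-- Infinitary formulas over the vocabulary `L` whose free variables are among those in `α`.
`all` is the universal quantifier `∀ x̄ φ` over a block `x̄ = (x_b)_{b : β}` of variables, and `split`
is the basic split `∀ x̄ ⋁_f ⋀_n φ_{f⁻¹(n)}(x̄, ȳ)` with `x̄ = (x_i)_{i : X}`, where `f` ranges over all
functions `X → ℕ` and the free variables of `φ_A` are among `ȳ` and `(x_i)_{i ∈ A}`.
The particular logics below are cut out by restricting which connectives and quantifiers occur. -/
inductive InfFormula (L : FirstOrder.Language.{u, u}) : Type u → Type (u + 1)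
  | equal {α : Type u} (t s : L.Term α) : InfFormula L α
  | rel {α : Type u} {n : ℕ} (R : L.Relations n) (ts : Fin n → L.Term α) : InfFormula L α
  | neg {α : Type u} (φ : InfFormula L α) : InfFormula L α
  | conj {α ι : Type u} (φ : ι → InfFormula L α) : InfFormula L α
  | all {α β : Type u} (φ : InfFormula L (α ⊕ β)) : InfFormula L α
  | split {α X : Type u} (φ : (A : Set X) → InfFormula L (α ⊕ A)) : InfFormula L α

namespace InfFormula

variable {L : FirstOrder.Language.{u, u}} {α ι β X : Type u}

/-- The disjunction `⋁ φ_i`. -/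
def disj (φ : ι → InfFormula L α) : InfFormula L α := neg (conj fun i => neg (φ i))

/-- The existential quantifier `∃ x̄ φ`. -/
def ex (φ : InfFormula L (α ⊕ β)) : InfFormula L α := neg (all (neg φ))

/-- The dual basic split `∃ x̄ ⋀_f ⋁_n φ_{f⁻¹(n)}(x̄, ȳ)`. -/
def exSplit (φ : (A : Set X) → InfFormula L (α ⊕ A)) : InfFormula L α :=
  neg (split fun A => neg (φ A))

/-- Satisfaction of a formula in a structure `M` under the assignment `v`. -/
def Realize (M : Type u) [L.Structure M] : {α : Type u} → InfFormula L α → (α → M) → Prop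
  | _, equal t s, v => t.realize v = s.realize v
  | _, rel R ts, v => FirstOrder.Language.Structure.RelMap R fun i => (ts i).realize v
  | _, neg φ, v => ¬ Realize M φ v
  | _, conj φ, v => ∀ i, Realize M (φ i) v
  | _, all (β := β) φ, v => ∀ c : β → M, Realize M φ (Sum.elim v c)
  | _, split (X := X) φ, v => ∀ c : X → M, ∃ f : X → ℕ, ∀ n : ℕ,
      Realize M (φ (f ⁻¹' {n})) (Sum.elim v fun x : (f ⁻¹' {n} : Set X) => c x)

theorem realize_disj (M : Type u) [L.Structure M] (φ : ι → InfFormula L α) (v : α → M) :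
    Realize M (disj φ) v ↔ ∃ i, Realize M (φ i) v := by
  simp [disj, Realize]

theorem realize_ex (M : Type u) [L.Structure M] (φ : InfFormula L (α ⊕ β)) (v : α → M) :
    Realize M (ex φ) v ↔ ∃ c : β → M, Realize M φ (Sum.elim v c) := by
  simp [ex, Realize]

theorem realize_exSplit (M : Type u) [L.Structure M] (φ : (A : Set X) → InfFormula L (α ⊕ A))
    (v : α → M) :
    Realize M (exSplit φ) v ↔ ∃ c : X → M, ∀ f : X → ℕ, ∃ n : ℕ,
      Realize M (φ (f ⁻¹' {n})) (Sum.elim v fun x : (f ⁻¹' {n} : Set X) => c x) := by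
  simp [exSplit, Realize]

theorem realize_equiv {M N : Type u} [L.Structure M] [L.Structure N] (e : M ≃[L] N)
    (φ : InfFormula L α) (v : α → M) : Realize N φ (e ∘ v) ↔ Realize M φ v := by
  induction φ with
  | equal t s =>
    simp only [Realize, FirstOrder.Language.HomClass.realize_term]
    exact e.injective.eq_iff
  | rel R ts =>
    simp only [Realize, FirstOrder.Language.HomClass.realize_term]
    exact e.map_rel R _
  | neg φ ih => exact not_congr (ih v)
  | conj φ ih => exact forall_congr' fun i => ih i v
  | all φ ih =>
    simp only [Realize]
    constructor
    · intro h c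
      rw [← ih, Sum.comp_elim]
      exact h _
    · intro h c
      have h' := (ih _).2 (h (e.symm ∘ c))
      rw [Sum.comp_elim] at h'
      convert h' using 2
      funext x
      simp
  | split φ ih =>
    simp only [Realize]
    constructor
    · intro h c
      obtain ⟨f, hf⟩ := h (e ∘ c)
      refine ⟨f, fun n => ?_⟩
      rw [← ih, Sum.comp_elim]
      exact hf n
    · intro h c
      obtain ⟨f, hf⟩ := h (e.symm ∘ c)
      refine ⟨f, fun n => ?_⟩
      have h' := (ih _ _).2 (hf n)
      rw [Sum.comp_elim] at h'
      convert h' using 2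
      funext x
      simp

/-- The formulas of `L_{lam, mu}`: conjunctions of fewer than `lam` formulas and quantifier blocks
of fewer than `mu` variables, no basic splits. -/
inductive MemL (lam mu : Cardinal.{u}) : {α : Type u} → InfFormula L α → Prop
  | equal {α : Type u} (t s : L.Term α) : MemL lam mu (equal t s)
  | rel {α : Type u} {n : ℕ} (R : L.Relations n) (ts : Fin n → L.Term α) : MemL lam mu (rel R ts)
  | neg {α : Type u} {φ : InfFormula L α} (h : MemL lam mu φ) : MemL lam mu (neg φ)
  | conj {α ι : Type u} {φ : ι → InfFormula L α} (hι : #ι < lam) (h : ∀ i, MemL lam mu (φ i)) :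
      MemL lam mu (conj φ)
  | all {α β : Type u} {φ : InfFormula L (α ⊕ β)} (hβ : #β < mu) (h : MemL lam mu φ) :
      MemL lam mu (all φ)

/-- The formulas of `L^{1,c}_{lam⁺, ≤ theta}`: the least class that contains `L_{theta⁺, ω}` and is
closed under negation, conjunctions of at most `lam` formulas with at most `theta` free variables
overall, quantification of a single variable, and basic splits with `len x̄, len ȳ ≤ theta`.
(Closure under disjunctions, `∃ x` and dual basic splits follows with negation, see below.) -/
inductive MemL1c (lam theta : Cardinal.{u}) : {α : Type u} → InfFormula L α → Prop
  | base {α : Type u} {φ : InfFormula L α} (h : MemL (Order.succ theta) ℵ₀ φ) : MemL1c lam theta φ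
  | neg {α : Type u} {φ : InfFormula L α} (h : MemL1c lam theta φ) : MemL1c lam theta (neg φ)
  | conj {α ι : Type u} {φ : ι → InfFormula L α} (hι : #ι ≤ lam) (hα : #α ≤ theta)
      (h : ∀ i, MemL1c lam theta (φ i)) : MemL1c lam theta (conj φ)
  | all {α β : Type u} {φ : InfFormula L (α ⊕ β)} (hβ : #β = 1) (h : MemL1c lam theta φ) :
      MemL1c lam theta (all φ)
  | split {α X : Type u} {φ : (A : Set X) → InfFormula L (α ⊕ A)} (hX : #X ≤ theta)
      (hα : #α ≤ theta) (h : ∀ A, MemL1c lam theta (φ A)) : MemL1c lam theta (split φ)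

theorem MemL1c.disj {lam theta : Cardinal.{u}} {φ : ι → InfFormula L α} (hι : #ι ≤ lam)
    (hα : #α ≤ theta) (h : ∀ i, MemL1c lam theta (φ i)) : MemL1c lam theta (disj φ) :=
  .neg (.conj hι hα fun i => .neg (h i))

theorem MemL1c.ex {lam theta : Cardinal.{u}} {φ : InfFormula L (α ⊕ β)} (hβ : #β = 1)
    (h : MemL1c lam theta φ) : MemL1c lam theta (ex φ) :=
  .neg (.all hβ (.neg h))

theorem MemL1c.exSplit {lam theta : Cardinal.{u}} {φ : (A : Set X) → InfFormula L (α ⊕ A)}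
    (hX : #X ≤ theta) (hα : #α ≤ theta) (h : ∀ A, MemL1c lam theta (φ A)) :
    MemL1c lam theta (exSplit φ) :=
  .neg (.split hX hα fun A => .neg (h A))

end InfFormula

/-- A class of (nonempty) `L`-structures. -/
abbrev ModelClass (L : FirstOrder.Language.{u, u}) : Type (u + 1) :=
  (M : Type u) → [L.Structure M] → [Nonempty M] → Prop

/-- An abstract logic: for every vocabulary a collection of sentences, and an isomorphism invariant
satisfaction relation. No closure properties are required. -/
structure AbstractLogic where
  Sentence : FirstOrder.Language.{u, u} → Type w
  Sat : {L : FirstOrder.Language.{u, u}} → Sentence L → ModelClass L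
  sat_iso : ∀ {L : FirstOrder.Language.{u, u}} (φ : Sentence L) (M N : Type u) [L.Structure M] [L.Structure N]
    [Nonempty M] [Nonempty N], (M ≃[L] N) → (Sat φ M ↔ Sat φ N)

namespace AbstractLogic

/-- The class `K` is the class of models of some sentence of the logic. -/
def Defines (A : AbstractLogic.{u, w}) {L : FirstOrder.Language.{u, u}} (K : ModelClass L) : Prop :=
  ∃ φ : A.Sentence L, ∀ (M : Type u) [L.Structure M] [Nonempty M], A.Sat φ M ↔ K M

/-- `A ≤ B`: every sentence of `A` has the same models as some sentence of `B` in the same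
vocabulary. -/
def IsSublogic (A : AbstractLogic.{u, w}) (B : AbstractLogic.{u, w'}) : Prop :=
  ∀ (L : FirstOrder.Language.{u, u}) (φ : A.Sentence L), B.Defines (A.Sat φ)

/-- `K` is `Σ` (that is, `PC`) in the logic `A`: it is a relativized reduct of an `A`-definable
class. There are an expansion `L.sum L₁` of the vocabulary, a unary predicate `P` of `L₁`, and a
sentence `χ` in the expanded vocabulary such that, up to isomorphism, the members of `K` are the
substructures with universe `P^M` of the `L`-reducts of the models `M` of `χ`. -/
def IsSigma (A : AbstractLogic.{u, w}) {L : FirstOrder.Language.{u, u}} (K : ModelClass L) : Prop :=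
  ∃ (L₁ : FirstOrder.Language.{u, u}) (P : L₁.Relations 1) (χ : A.Sentence (L.sum L₁)),
    ∀ (N : Type u) [L.Structure N] [Nonempty N],
      K N ↔ ∃ (M : Type u) (_ : L.Structure M) (_ : L₁.Structure M) (_ : Nonempty M),
        A.Sat χ M ∧ ∃ e : N ↪[L] M, Set.range e = {x | FirstOrder.Language.Structure.RelMap P ![x]}

/-- `K` is `Π` in `A`: its complement is `Σ`. -/
def IsPi (A : AbstractLogic.{u, w}) {L : FirstOrder.Language.{u, u}} (K : ModelClass L) : Prop :=
  A.IsSigma (L := L) fun M _ _ => ¬ K M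

/-- `K` is `Δ` in `A`: it is both `Σ` and `Π`. -/
def IsDelta (A : AbstractLogic.{u, w}) {L : FirstOrder.Language.{u, u}} (K : ModelClass L) : Prop :=
  A.IsSigma K ∧ A.IsPi K

/-- The Souslin-Kleene property. -/
def SouslinKleene (A : AbstractLogic.{u, w}) : Prop :=
  ∀ (L : FirstOrder.Language.{u, u}) (K : ModelClass L), A.IsDelta K → A.Defines K

theorem IsSigma.iso {A : AbstractLogic.{u, w}} {L : FirstOrder.Language.{u, u}} {K : ModelClass L}
    (h : A.IsSigma K) (M N : Type u) [L.Structure M] [L.Structure N] [Nonempty M] [Nonempty N]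
    (e : M ≃[L] N) : K M → K N := by
  obtain ⟨L₁, P, χ, h⟩ := h
  rw [h M, h N]
  rintro ⟨M', i₁, i₂, i₃, hχ, g, hg⟩
  refine ⟨M', i₁, i₂, i₃, hχ, g.comp e.symm.toEmbedding, ?_⟩
  rw [← hg]
  ext x
  constructor
  · rintro ⟨y, rfl⟩
    exact ⟨e.symm y, rfl⟩
  · rintro ⟨y, rfl⟩
    exact ⟨e y, by simp⟩

/-- The logic `Δ(A)`: a class is definable in it exactly if it is `Δ` in `A`. -/
def Delta (A : AbstractLogic.{u, w}) : AbstractLogic.{u, u + 1} where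
  Sentence L := {K : ModelClass L // A.IsDelta K}
  Sat K M _ _ := K.1 M
  sat_iso K M N _ _ _ _ e := ⟨K.2.1.iso M N e, K.2.1.iso N M e.symm⟩

theorem delta_defines_iff (A : AbstractLogic.{u, w}) {L : FirstOrder.Language.{u, u}} (K : ModelClass L) :
    A.Delta.Defines K ↔ A.IsDelta K := by
  constructor
  · rintro ⟨⟨K', hK'⟩, h⟩
    have : K' = K := by
      funext M _ _
      exact propext (h M)
    exact this ▸ hK'
  · intro h
    exact ⟨⟨K, h⟩, fun M _ _ => Iff.rfl⟩

theorem IsSigma.mono {A : AbstractLogic.{u, w}} {B : AbstractLogic.{u, w'}} (hAB : A.IsSublogic B)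
    {L : FirstOrder.Language.{u, u}} {K : ModelClass L} (h : A.IsSigma K) : B.IsSigma K := by
  obtain ⟨L₁, P, χ, h⟩ := h
  obtain ⟨χ', hχ'⟩ := hAB _ χ
  refine ⟨L₁, P, χ', fun N _ _ => ?_⟩
  rw [h N]
  refine exists_congr fun M => exists_congr fun _ => exists_congr fun _ => exists_congr fun _ => ?_
  rw [hχ' M]

/-- `Δ(A)` is contained in every logic that contains `A` and has the Souslin-Kleene property. -/
theorem delta_isSublogic {A : AbstractLogic.{u, w}} {B : AbstractLogic.{u, w'}}
    (hAB : A.IsSublogic B) (hB : B.SouslinKleene) : A.Delta.IsSublogic B :=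
  fun L K => hB L K.1 ⟨K.2.1.mono hAB, K.2.2.mono hAB⟩

end AbstractLogic

open InfFormula

/-- The logic `L_{κκ}`, the union of the logics `L_{θ⁺ θ⁺}` for `θ < κ`. -/
def Lkk (κ : Cardinal.{u}) : AbstractLogic.{u, u + 1} where
  Sentence L := {φ : InfFormula L PEmpty.{u + 1} //
    ∃ θ < κ, MemL (Order.succ θ) (Order.succ θ) φ}
  Sat φ M _ _ := Realize M φ.1 PEmpty.elim
  sat_iso φ M N _ _ _ _ e := by
    rw [← realize_equiv e, Subsingleton.elim (e ∘ PEmpty.elim) PEmpty.elim]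

/-- The logic `L^{1,c}_κ`, the union of the logics `L^{1,c}_{lam⁺, ≤ θ}` for `θ, lam < κ` with
`cf θ > ω`. -/
def L1c (κ : Cardinal.{u}) : AbstractLogic.{u, u + 1} where
  Sentence L := {φ : InfFormula L PEmpty.{u + 1} //
    ∃ θ < κ, ℵ₀ < θ.ord.cof ∧ ∃ lam < κ, MemL1c lam θ φ}
  Sat φ M _ _ := Realize M φ.1 PEmpty.elim
  sat_iso φ M N _ _ _ _ e := by
    rw [← realize_equiv e, Subsingleton.elim (e ∘ PEmpty.elim) PEmpty.elim]

/-- The map `f : M → N` (in the application, an inclusion `M ⊆ N`) is `L_{θ⁺ θ⁺}`-elementary. -/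
def IsElementary {L : FirstOrder.Language.{u, u}} (θ : Cardinal.{u}) {M N : Type u} [L.Structure M]
    [L.Structure N] (f : M ↪[L] N) : Prop :=
  ∀ (α : Type u) (φ : InfFormula L α), MemL (Order.succ θ) (Order.succ θ) φ →
    ∀ v : α → M, Realize M φ v ↔ Realize N φ (f ∘ v)

/-- The Union Lemma for the sentence `ψ` and for `≺_{θ⁺ θ⁺}`-elementary chains: if a structure `M`
is the union of an increasing chain `(S n)_{n < ω}` of substructures with `S n ≺_{θ⁺ θ⁺} S (n + 1)`
for all `n`, then `S n ⊨ ψ` if and only if `M ⊨ ψ`, for all `n`. -/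
def UnionLemmaFor (A : AbstractLogic.{u, w}) {L : FirstOrder.Language.{u, u}} (ψ : A.Sentence L)
    (θ : Cardinal.{u}) : Prop :=
  ∀ (M : Type u) [L.Structure M] [Nonempty M] (S : ℕ → L.Substructure M) [∀ n, Nonempty (S n)]
    (hS : Monotone S), (∀ x : M, ∃ n, x ∈ S n) →
    (∀ n, IsElementary θ (FirstOrder.Language.Substructure.inclusion (hS (Nat.le_succ n)))) →
    ∀ n, A.Sat ψ (S n) ↔ A.Sat ψ M

/-- The Union Lemma for a logic, below `κ`: each sentence satisfies the Union Lemma for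
`≺_{θ⁺ θ⁺}`-elementary chains once `θ < κ` is large enough (the condition gets weaker as `θ`
grows). -/
def HasUnionLemma (A : AbstractLogic.{u, w}) (κ : Cardinal.{u}) : Prop :=
  ∀ (L : FirstOrder.Language.{u, u}) (ψ : A.Sentence L), ∃ θ < κ, UnionLemmaFor A ψ θ

/-- The symbols of the vocabulary `{R}`, with `R` binary. -/
inductive BinRel : ℕ → Type u
  | R : BinRel 2

/-- The vocabulary with a single symbol, a binary relation symbol `R`. -/
def binLang : FirstOrder.Language.{u, u} := ⟨fun _ => PEmpty.{u + 1}, BinRel.{u}⟩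

/-- The symbol `R`. -/
def binSymb : binLang.{u}.Relations 2 := BinRel.R

/-- The class of structures `(M, R)` such that every fiber `R(a, ·)` has at most `mu` elements and
every subset of `M` with at most `mu` elements is covered by countably many fibers. The covering
sentence `Θ_mu` is a sentence that defines this class. -/
def CoveringClass (mu : Cardinal.{u}) : ModelClass binLang.{u} := fun M _ _ =>
  (∀ a : M, #{x : M | FirstOrder.Language.Structure.RelMap binSymb ![a, x]} ≤ mu) ∧
  ∀ X : Set M, #X ≤ mu → ∃ a : ℕ → M,
    X ⊆ ⋃ n, {x : M | FirstOrder.Language.Structure.RelMap binSymb ![a n, x]}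

end InfLogic

/-! A sentence of the logic becomes an `L_{θ⁺θ⁺}` sentence `φ` that is invariant under unions of
`≺_{θ⁺θ⁺}`-chains, for one `θ < κ`. Its negation has both properties too, so it suffices that the
models of such a `φ` form a `Σ` class (`isSigma_of_unionInvariant`).

By `exists_support`, `φ` uses at most `θ` symbols, and all others may be made trivial around a base
point `p`. Let `#Λ = 2 ^ θ`, so that `#Λ ^ θ = #Λ`. In the expanded structure, `P` is the structure
`N` to be described, and each element `a` codes the family `(F i a)` indexed by `Λ`, meant to
enumerate a small elementary substructure of `N`. The coding sentence says that the families lie in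
`P`, that any two of them have a joint atomic diagram occurring for two enumerated elementary
substructures of some model of `φ`, that the ranges are directed, and that every `Λ`-sequence in `P`
is covered by countably many ranges. Only the last clause needs a basic split.

If `N ⊨ φ`, downward Löwenheim–Skolem (`exists_elementary_substructure`) supplies all the codes.
Conversely (`realize_of_covering`), good diagrams make each range a model of `φ`, and inclusions
between ranges elementary. Countable covering and directedness yield a chain of ranges and a chain
of small elementary substructures of `N` with the same union. Union invariance, applied to both
chains, carries `φ` from the ranges to the union and from there to `N`. -/

namespace InfLogic

open InfFormula FirstOrder FirstOrder.Language FirstOrder.Language.Structure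

/-! ### Unnested diagrams and symbol support -/

section

variable {L : FirstOrder.Language.{u, u}}

/-- Unnested atomic formulas in the symbols `SF`, `SR` with variables in `V`. -/
inductive UAtom (SF : Set (Σ n, L.Functions n)) (SR : Set (Σ n, L.Relations n)) (V : Type u) :
    Type u
  | eq (x y : V) : UAtom SF SR V
  | fn (f : SF) (x : Fin f.1.1 → V) (y : V) : UAtom SF SR V
  | rel (r : SR) (x : Fin r.1.1 → V) : UAtom SF SR V

variable {SF : Set (Σ n, L.Functions n)} {SR : Set (Σ n, L.Relations n)} {V V' : Type u}

namespace UAtom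

/-- Satisfaction of an unnested atomic formula. -/
def Holds {N : Type u} [L.Structure N] (v : V → N) : UAtom SF SR V → Prop
  | eq x y => v x = v y
  | fn f x y => funMap f.1.2 (v ∘ x) = v y
  | rel r x => RelMap r.1.2 (v ∘ x)

/-- Renaming of variables. -/
def map (g : V → V') : UAtom SF SR V → UAtom SF SR V'
  | eq x y => eq (g x) (g y)
  | fn f x y => fn f (g ∘ x) (g y)
  | rel r x => rel r (g ∘ x)

theorem holds_map {N : Type u} [L.Structure N] (g : V → V') (v : V' → N) (a : UAtom SF SR V) :
    (a.map g).Holds v ↔ a.Holds (v ∘ g) := by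
  cases a <;> rfl

theorem holds_embedding {M N : Type u} [L.Structure M] [L.Structure N] (e : M ↪[L] N) (v : V → M)
    (a : UAtom SF SR V) : a.Holds (e ∘ v) ↔ a.Holds v := by
  cases a with
  | eq x y => exact e.injective.eq_iff
  | fn f x y =>
    simp only [Holds]
    rw [Function.comp_assoc, ← e.map_fun]
    exact e.injective.eq_iff
  | rel r x =>
    simp only [Holds]
    rw [Function.comp_assoc, e.map_rel]

theorem mk_le {c : Cardinal.{u}} (hc : ℵ₀ ≤ c) (hF : #SF ≤ c) (hR : #SR ≤ c) (hV : #V ≤ c) :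
    #(UAtom SF SR V) ≤ c := by
  let g : (V × V) ⊕ ((Σ f : SF, (Fin f.1.1 → V)) × V) ⊕ (Σ r : SR, (Fin r.1.1 → V)) →
      UAtom SF SR V :=
    Sum.elim (fun p => eq p.1 p.2) (Sum.elim (fun p => fn p.1.1 p.1.2 p.2) (fun p => rel p.1 p.2))
  have hg : Function.Surjective g := by
    rintro (⟨x, y⟩ | ⟨f, x, y⟩ | ⟨r, x⟩)
    · exact ⟨.inl (x, y), rfl⟩
    · exact ⟨.inr (.inl (⟨f, x⟩, y)), rfl⟩
    · exact ⟨.inr (.inr ⟨r, x⟩), rfl⟩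
  have hpow : ∀ n : ℕ, #(Fin n → V) ≤ c := fun n => by
    have : #(Fin n → V) = #V ^ n := by simp
    rw [this]
    exact (pow_le_pow_left' hV n).trans (Cardinal.power_nat_le hc)
  have hsig : ∀ (S : Type u) (k : S → ℕ), #S ≤ c → #(Σ s : S, (Fin (k s) → V)) ≤ c := by
    intro S k hS
    rw [mk_sigma]
    refine (sum_le_sum _ (fun _ => c) fun s => hpow _).trans ?_
    rw [sum_const']
    exact (mul_le_mul' hS le_rfl).trans (mul_eq_self hc).le
  refine (mk_le_of_surjective hg).trans ?_
  simp only [mk_sum, lift_id, mk_prod]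
  refine add_le_of_le hc ?_ (add_le_of_le hc ?_ (hsig _ _ hR))
  · exact (mul_le_mul' hV hV).trans (mul_eq_self hc).le
  · exact (mul_le_mul' (hsig _ _ hF) hV).trans (mul_eq_self hc).le

end UAtom

variable (SF SR) in
/-- All function symbols outside `SF` are constant with value `p`, and all relation symbols outside
`SR` are empty. -/
structure IsTriv (N : Type u) [L.Structure N] (p : N) : Prop where
  fn : ∀ {n} (f : L.Functions n), (⟨n, f⟩ : Σ n, L.Functions n) ∉ SF → ∀ x : Fin n → N,
    funMap f x = p
  rel : ∀ {n} (r : L.Relations n), (⟨n, r⟩ : Σ n, L.Relations n) ∉ SR → ∀ x : Fin n → N,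
    ¬ RelMap r x

theorem IsTriv.substructure {N : Type u} [L.Structure N] {p : N} (h : IsTriv SF SR N p)
    (T : L.Substructure N) (hp : p ∈ T) : IsTriv SF SR T ⟨p, hp⟩ where
  fn f hf _ := Subtype.ext (h.fn f hf _)
  rel r hr _ := h.rel r hr _

/-- Two families enumerating trivial structures with the same unnested diagram have the same terms. -/
theorem realize_term_of_diagram {N N' : Type u} [L.Structure N] [L.Structure N'] {p : N} {p' : N'}
    (h : IsTriv SF SR N p) (h' : IsTriv SF SR N' p') {A : Type u} {v : A → N} {w : A → N'}
    (hw : Function.Surjective w) (i₀ : A) (hv₀ : v i₀ = p) (hw₀ : w i₀ = p')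
    (hd : ∀ a : UAtom SF SR A, a.Holds v ↔ a.Holds w) {α : Type u} (t : L.Term α) (s : α → A) :
    ∃ j, t.realize (v ∘ s) = v j ∧ t.realize (w ∘ s) = w j := by
  induction t with
  | var a => exact ⟨s a, rfl, rfl⟩
  | func f ts ih =>
    choose x hx hx' using ih
    simp only [Term.realize, hx, hx']
    by_cases hf : (⟨_, f⟩ : Σ n, L.Functions n) ∈ SF
    · obtain ⟨j, hj⟩ := hw (funMap f (w ∘ x))
      exact ⟨j, (hd (.fn ⟨_, hf⟩ x j)).2 hj.symm, hj.symm⟩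
    · exact ⟨i₀, (h.fn f hf _).trans hv₀.symm, (h'.fn f hf _).trans hw₀.symm⟩

/-- Both enumerations are onto, so any block of quantified elements on one side has indices in `A`,
and the same indices answer on the other side. Hence the atomic diagram decides formulas with blocks
of any length. -/
theorem realize_iff_of_diagram {N N' : Type u} [L.Structure N] [L.Structure N'] {p : N} {p' : N'}
    (h : IsTriv SF SR N p) (h' : IsTriv SF SR N' p') {A : Type u} {v : A → N} {w : A → N'}
    (hv : Function.Surjective v) (hw : Function.Surjective w) (i₀ : A) (hv₀ : v i₀ = p)
    (hw₀ : w i₀ = p') (hd : ∀ a : UAtom SF SR A, a.Holds v ↔ a.Holds w) {lam mu : Cardinal.{u}}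
    {α : Type u} {φ : InfFormula L α} (hφ : MemL lam mu φ) (s : α → A) :
    Realize N φ (v ∘ s) ↔ Realize N' φ (w ∘ s) := by
  induction hφ with
  | equal t t' =>
    obtain ⟨j, hj, hj'⟩ := realize_term_of_diagram h h' hw i₀ hv₀ hw₀ hd t s
    obtain ⟨k, hk, hk'⟩ := realize_term_of_diagram h h' hw i₀ hv₀ hw₀ hd t' s
    simp only [Realize, hj, hj', hk, hk']
    exact hd (.eq j k)
  | @rel _ n R ts =>
    have := fun i => realize_term_of_diagram h h' hw i₀ hv₀ hw₀ hd (ts i) s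
    choose x hx hx' using this
    simp only [Realize, hx, hx']
    by_cases hR : (⟨_, R⟩ : Σ n, L.Relations n) ∈ SR
    · exact hd (.rel ⟨_, hR⟩ x)
    · exact iff_of_false (h.rel R hR _) (h'.rel R hR _)
  | neg _ ih => exact not_congr (ih s)
  | conj _ _ ih => exact forall_congr' fun i => ih i s
  | all _ _ ih =>
    simp only [Realize]
    constructor
    · intro H c
      choose t ht using fun b => hw (c b)
      have := (ih (Sum.elim s t)).1 (by rw [Sum.comp_elim]; exact H _)
      rw [Sum.comp_elim] at this
      convert this using 2
      exact funext fun b => (ht b).symm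
    · intro H c
      choose t ht using fun b => hv (c b)
      have := (ih (Sum.elim s t)).2 (by rw [Sum.comp_elim]; exact H _)
      rw [Sum.comp_elim] at this
      convert this using 2
      exact funext fun b => (ht b).symm

/-- Satisfaction of a term depends only on finitely many symbols. -/
theorem exists_term_support {α : Type u} (t : L.Term α) :
    ∃ SF : Set (Σ n, L.Functions n), #SF ≤ ℵ₀ ∧ ∀ (M : Type u) (i₁ i₂ : L.Structure M),
      (∀ s ∈ SF, i₁.funMap s.2 = i₂.funMap s.2) →
      ∀ v : α → M, @Term.realize L M i₁ α v t = @Term.realize L M i₂ α v t := by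
  induction t with
  | var a => exact ⟨∅, by simp, fun _ _ _ _ _ => rfl⟩
  | @func n f ts ih =>
    choose S hS h using ih
    refine ⟨insert ⟨n, f⟩ (⋃ i, S i), ?_, fun M i₁ i₂ H v => ?_⟩
    · rw [le_aleph0_iff_set_countable]
      exact (Set.countable_iUnion fun i => le_aleph0_iff_set_countable.1 (hS i)).insert _
    · simp only [Term.realize]
      rw [H ⟨n, f⟩ (Set.mem_insert _ _)]
      congr 1
      funext i
      exact h i M i₁ i₂ (fun s hs => H s (Set.mem_insert_of_mem _ (Set.mem_iUnion_of_mem i hs))) v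

/-- A formula of `L_{θ⁺, μ}` depends only on at most `θ` symbols. -/
theorem exists_support {θ mu : Cardinal.{u}} (hθ : ℵ₀ ≤ θ) {α : Type u} {φ : InfFormula L α}
    (hφ : MemL (Order.succ θ) mu φ) :
    ∃ (SF : Set (Σ n, L.Functions n)) (SR : Set (Σ n, L.Relations n)), #SF ≤ θ ∧ #SR ≤ θ ∧
      ∀ (M : Type u) (i₁ i₂ : L.Structure M),
      (∀ s ∈ SF, i₁.funMap s.2 = i₂.funMap s.2) → (∀ s ∈ SR, i₁.RelMap s.2 = i₂.RelMap s.2) →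
      ∀ v : α → M, @Realize L M i₁ α φ v ↔ @Realize L M i₂ α φ v := by
  induction hφ with
  | equal t t' =>
    obtain ⟨S, hS, h⟩ := exists_term_support t
    obtain ⟨S', hS', h'⟩ := exists_term_support t'
    refine ⟨S ∪ S', ∅, ?_, by simp, fun M i₁ i₂ H _ v => ?_⟩
    · exact (mk_union_le _ _).trans (add_le_of_le hθ (hS.trans hθ) (hS'.trans hθ))
    · simp only [Realize]
      rw [h M i₁ i₂ (fun s hs => H s (.inl hs)) v, h' M i₁ i₂ (fun s hs => H s (.inr hs)) v]
  | @rel _ n R ts =>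
    choose S hS h using fun i => exists_term_support (ts i)
    refine ⟨⋃ i, S i, {⟨n, R⟩}, ?_, ?_, fun M i₁ i₂ H H' v => ?_⟩
    · refine le_trans ?_ hθ
      rw [le_aleph0_iff_set_countable]
      exact Set.countable_iUnion fun i => le_aleph0_iff_set_countable.1 (hS i)
    · rw [mk_singleton]
      exact one_le_aleph0.trans hθ
    · simp only [Realize]
      rw [H' ⟨n, R⟩ rfl]
      have : (fun i => @Term.realize L M i₁ _ v (ts i)) = fun i => @Term.realize L M i₂ _ v (ts i) :=
        funext fun i => h i M i₁ i₂ (fun s hs => H s (Set.mem_iUnion_of_mem i hs)) v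
      rw [this]
  | neg _ ih =>
    obtain ⟨SF, SR, hF, hR, h⟩ := ih
    exact ⟨SF, SR, hF, hR, fun M i₁ i₂ H H' v => not_congr (h M i₁ i₂ H H' v)⟩
  | @conj _ ι _ hι _ ih =>
    choose SF SR hF hR h using ih
    have hU : ∀ {T : Type u} (S : ι → Set T), (∀ i, #(S i) ≤ θ) → #(⋃ i, S i) ≤ θ := by
      intro T S hS
      refine (mk_iUnion_le_sum_mk).trans ((sum_le_sum _ (fun _ => θ) hS).trans ?_)
      rw [sum_const']
      exact (mul_le_mul' (Order.lt_succ_iff.1 hι) le_rfl).trans (mul_eq_self hθ).le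
    exact ⟨⋃ i, SF i, ⋃ i, SR i, hU _ hF, hU _ hR, fun M i₁ i₂ H H' v =>
      forall_congr' fun i => h i M i₁ i₂ (fun s hs => H s (Set.mem_iUnion_of_mem i hs))
        (fun s hs => H' s (Set.mem_iUnion_of_mem i hs)) v⟩
  | all _ _ ih =>
    obtain ⟨SF, SR, hF, hR, h⟩ := ih
    exact ⟨SF, SR, hF, hR, fun M i₁ i₂ H H' v => forall_congr' fun c => h M i₁ i₂ H H' _⟩

theorem InfFormula.MemL.mono {lam lam' mu mu' : Cardinal.{u}} (hl : lam ≤ lam') (hm : mu ≤ mu')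
    {α : Type u} {φ : InfFormula L α} (h : MemL lam mu φ) : MemL lam' mu' φ := by
  induction h with
  | equal t s => exact .equal t s
  | rel R ts => exact .rel R ts
  | neg _ ih => exact .neg ih
  | conj hι _ ih => exact .conj (hι.trans_le hl) ih
  | all hβ _ ih => exact .all (hβ.trans_le hm) ih

theorem IsElementary.mono {θ θ' : Cardinal.{u}} (h : θ ≤ θ') {M N : Type u} [L.Structure M]
    [L.Structure N] {f : M ↪[L] N} (hf : IsElementary θ' f) : IsElementary θ f :=
  fun α φ hφ v => hf α φ (hφ.mono (Order.succ_le_succ h) (Order.succ_le_succ h)) v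

end

/-! ### Small codes for infinitary formulas -/

section

variable {L : FirstOrder.Language.{u, u}}

/-- A node has at most `c` labels and `c ^ θ ≤ c` choices of children, so `c` bounds the
well-founded trees. This counts both formula codes and closures under Skolem functions. -/
theorem mk_wType_le {c θ : Cardinal.{u}} (hc : ℵ₀ ≤ c) (hcθ : c ^ θ ≤ c) {A : Type u}
    {β : A → Type u} (hA : #A ≤ c) (hβ : ∀ a, #(β a) ≤ θ) : #(WType β) ≤ c := by
  refine WType.cardinalMk_le_of_le ((sum_le_sum _ (fun _ => c) fun a => ?_).trans ?_)
  · exact (power_le_power_left (aleph0_pos.trans_le hc).ne' (hβ a)).trans hcθ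
  · rw [sum_const']
    exact (mul_le_mul' hA le_rfl).trans (mul_eq_self hc).le

/-- Codes for infinitary formulas with variables in `V`: `node σ w` codes
`∀ c ∃ i ¬ w i`, where the variables of `w i` are substituted according to `σ`. -/
inductive WForm (SF : Set (Σ n, L.Functions n)) (SR : Set (Σ n, L.Relations n)) (V : Type u) :
    Type u
  | atom (a : UAtom SF SR V) : WForm SF SR V
  | node (σ : V → V ⊕ V) (w : V → WForm SF SR V) : WForm SF SR V

variable {SF : Set (Σ n, L.Functions n)} {SR : Set (Σ n, L.Relations n)} {V : Type u}

namespace WForm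

/-- Satisfaction of coded formulas. -/
def Holds {N : Type u} [L.Structure N] : WForm SF SR V → (V → N) → Prop
  | atom a, v => a.Holds v
  | node σ w, v => ∀ c : V → N, ∃ i, ¬ (w i).Holds (Sum.elim v c ∘ σ)

/-- Coded formulas as a `W`-type. -/
def toWType : WForm SF SR V →
    WType (Sum.elim (fun _ => PEmpty) (fun _ => V) : UAtom SF SR V ⊕ (V → V ⊕ V) → Type u)
  | atom a => .mk (.inl a) PEmpty.elim
  | node σ w => .mk (.inr σ) fun i : V => (w i).toWType

theorem toWType_injective : Function.Injective (toWType : WForm SF SR V → _) := by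
  refine Function.LeftInverse.injective (g := WType.elim (WForm SF SR V) fun x =>
    match x with
    | ⟨Sum.inl a, _⟩ => atom a
    | ⟨Sum.inr σ, w⟩ => node σ w) fun x => ?_
  induction x with
  | atom a => rfl
  | node σ w ih => exact congrArg (node σ) (funext ih)

/-- Formulas themselves live in a higher universe and come with arbitrary index types; the codes
form a small type, and this bound limits the number of Skolem functions needed. -/
theorem mk_le {c : Cardinal.{u}} [Infinite V] (hF : #SF ≤ #V) (hR : #SR ≤ #V) (hVc : #V ≤ c)
    (hc : c ^ #V ≤ c) : #(WForm SF SR V) ≤ c := by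
  have hV := aleph0_le_mk V
  refine (mk_le_of_injective toWType_injective).trans
    (mk_wType_le (hV.trans hVc) hc ?_ (θ := #V) ?_)
  · rw [mk_sum, lift_id, lift_id]
    refine add_le_of_le (hV.trans hVc) ((UAtom.mk_le hV hF hR le_rfl).trans hVc) ?_
    rw [mk_arrow, lift_id, lift_id, mk_sum, lift_id, add_eq_self hV]
    exact (power_le_power_right hVc).trans hc
  · rintro (a | σ) <;> simp

/-- Negation. -/
def neg (w : WForm SF SR V) : WForm SF SR V := node Sum.inl fun _ => w

/-- Renaming of variables. -/
def ren (g : V → V) (w : WForm SF SR V) : WForm SF SR V := node (Sum.inl ∘ g) fun _ => w.neg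

/-- Conjunction. -/
def conj (w : V → WForm SF SR V) : WForm SF SR V := neg (node Sum.inl w)

/-- Universal quantification. -/
def all (σ : V → V ⊕ V) (w : WForm SF SR V) : WForm SF SR V := node σ fun _ => w.neg

variable {N : Type u} [L.Structure N] [Nonempty V]

theorem holds_neg (w : WForm SF SR V) (v : V → N) : w.neg.Holds v ↔ ¬ w.Holds v := by
  simp only [neg, Holds, Sum.elim_comp_inl, exists_const]
  exact ⟨fun h => h v, fun h _ => h⟩

theorem holds_ren (g : V → V) (w : WForm SF SR V) (v : V → N) :
    (w.ren g).Holds v ↔ w.Holds (v ∘ g) := by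
  simp only [ren, Holds, ← Function.comp_assoc, Sum.elim_comp_inl, exists_const, holds_neg, not_not]
  exact ⟨fun h => h v, fun h _ => h⟩

theorem holds_conj (w : V → WForm SF SR V) (v : V → N) : (conj w).Holds v ↔ ∀ i, (w i).Holds v := by
  rw [conj, holds_neg]
  simp only [Holds, Sum.elim_comp_inl]
  push Not
  exact ⟨fun ⟨_, h⟩ => h, fun h => ⟨v, h⟩⟩

theorem holds_all (σ : V → V ⊕ V) (w : WForm SF SR V) (v : V → N) :
    (all σ w).Holds v ↔ ∀ c : V → N, w.Holds (Sum.elim v c ∘ σ) := by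
  simp only [all, Holds, exists_const, holds_neg, not_not]

end WForm

variable (SF SR V) in
/-- The property `Q` of assignments `α → N` in trivial structures is expressed by a coded formula. -/
def Exp {α : Type u} (Q : (N : Type u) → [L.Structure N] → N → (α → N) → Prop) : Prop :=
  ∃ (w : WForm SF SR V) (s : V → Option α), ∀ (N : Type u) [L.Structure N] (p : N),
    IsTriv SF SR N p → ∀ v : α → N, Q N p v ↔ w.Holds fun k => (s k).elim p v

namespace Exp

variable {α β : Type u} {Q Q' : (N : Type u) → [L.Structure N] → N → (α → N) → Prop}

theorem congr (h : Exp SF SR V Q) (hQ : ∀ (N : Type u) [L.Structure N] (p : N),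
    IsTriv SF SR N p → ∀ v : α → N, Q' N p v ↔ Q N p v) : Exp SF SR V Q' := by
  obtain ⟨w, s, h⟩ := h
  exact ⟨w, s, fun N _ p hp v => (hQ N p hp v).trans (h N p hp v)⟩

theorem rename {Q : (N : Type u) → [L.Structure N] → N → (α → N) → Prop} (g : α → β)
    (h : Exp SF SR V Q) : Exp SF SR V fun N _ p (v : β → N) => Q N p (v ∘ g) := by
  obtain ⟨w, s, h⟩ := h
  refine ⟨w, fun k => (s k).map g, fun N _ p hp v => (h N p hp _).trans ?_⟩
  refine iff_of_eq (congrArg _ (funext fun k => ?_))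
  simp only
  cases s k <;> rfl

variable [Infinite V]

theorem atom (a : UAtom SF SR (Option α)) :
    Exp SF SR V fun N _ p (v : α → N) => a.Holds fun k : Option α => k.elim p v := by
  classical
  -- The finitely many variables get distinct slots of `V`; every other slot reads the base point.
  have key : ∀ {n : ℕ} (x : Fin n → Option α), ∃ (s : V → Option α) (g : Fin n → V),
      ∀ i, s (g i) = x i := fun {n} x =>
    ⟨Function.extend (fun i : Fin n => Infinite.natEmbedding V i) x fun _ => none,
      fun i => Infinite.natEmbedding V i, fun i =>
      (((Infinite.natEmbedding V).injective.comp Fin.val_injective).extend_apply _ _ i)⟩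
  cases a with
  | eq x y =>
    obtain ⟨s, g, h⟩ := key ![x, y]
    refine ⟨.atom (.eq (g 0) (g 1)), s, fun N _ p hp v => ?_⟩
    simp [WForm.Holds, UAtom.Holds, h]
  | fn f x y =>
    obtain ⟨s, g, h⟩ := key (Fin.cons y x : Fin (f.1.1 + 1) → Option α)
    refine ⟨.atom (.fn f (fun i => g i.succ) (g 0)), s, fun N _ p hp v => ?_⟩
    simp [WForm.Holds, UAtom.Holds, h, Function.comp_def]
  | rel r x =>
    obtain ⟨s, g, h⟩ := key x
    refine ⟨.atom (.rel r g), s, fun N _ p hp v => ?_⟩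
    simp [WForm.Holds, UAtom.Holds, h, Function.comp_def]

theorem neg (h : Exp SF SR V Q) : Exp SF SR V fun N _ p v => ¬ Q N p v := by
  obtain ⟨w, s, h⟩ := h
  exact ⟨w.neg, s, fun N _ p hp v => by
    rw [WForm.holds_neg]
    exact not_congr (h N p hp v)⟩

/-- The conjuncts come with different assignments of slots. A bijection of `V` with `V × V` gives
each its own block of slots, and a surjection of `V` onto `ι` makes the conjunction exactly `V`-ary.
-/
theorem conj {ι : Type u} (hι : #ι ≤ #V)
    {Q : ι → (N : Type u) → [L.Structure N] → N → (α → N) → Prop}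
    (h : ∀ i, Exp SF SR V (Q i)) : Exp SF SR V fun N _ p v => ∀ i, Q i N p v := by
  choose w s h using h
  obtain ⟨k₀⟩ : Nonempty V := inferInstance
  rcases isEmpty_or_nonempty ι with hι' | hι'
  · refine ⟨.atom (.eq k₀ k₀), fun _ => none, fun N _ p _ v => ?_⟩
    simp [WForm.Holds, UAtom.Holds]
  · obtain ⟨e⟩ := hι
    obtain ⟨q⟩ : Nonempty (V ≃ V × V) := by
      rw [← Cardinal.eq, mk_prod, lift_id, mul_eq_self (aleph0_le_mk V)]
    let r := Function.invFun e
    refine ⟨.conj fun k => (w (r k)).ren fun b => q.symm (k, b),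
      fun k => s (r (q k).1) (q k).2, fun N _ p hp v => ?_⟩
    simp only [WForm.holds_conj, WForm.holds_ren, Function.comp_def, Equiv.apply_symm_apply]
    rw [← (Function.invFun_surjective e.injective).forall (p := fun i =>
      (w i).Holds fun k => (s i k).elim p v)]
    exact forall_congr' fun i => h i N p hp v

/-- Slots reading a bound variable `b` are redirected to coordinate `e b` of the fresh block.
Coordinates off the range of `e` are never read, so they may be filled with `p`. -/
theorem all (hβ : #β ≤ #V)
    {Q : (N : Type u) → [L.Structure N] → N → (α ⊕ β → N) → Prop} (h : Exp SF SR V Q) :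
    Exp SF SR V fun N _ p (v : α → N) => ∀ c : β → N, Q N p (Sum.elim v c) := by
  obtain ⟨w, s, h⟩ := h
  obtain ⟨e⟩ := hβ
  refine ⟨.all (fun k => (s k).elim (.inl k) (Sum.elim (fun _ => .inl k) fun b => .inr (e b))) w,
    fun k => (s k).bind (Sum.elim some fun _ => none), fun N _ p hp v => ?_⟩
  rw [WForm.holds_all]
  have : ∀ c : V → N, Q N p (Sum.elim v (c ∘ e)) ↔
      w.Holds (Sum.elim (fun k => ((s k).bind (Sum.elim some fun _ => none)).elim p v) c ∘ fun k =>
        (s k).elim (.inl k) (Sum.elim (fun _ => .inl k) fun b => .inr (e b))) := fun c => by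
    rw [h N p hp]
    refine iff_of_eq (congrArg _ (funext fun k => ?_))
    rcases hk : s k with _ | (a | b) <;> simp [hk]
  simp only [← this]
  refine ⟨fun H c => H _, fun H c => ?_⟩
  have := H (Function.extend e c fun _ => p)
  rwa [Function.extend_comp e.injective] at this

theorem and (h : Exp SF SR V Q) (h' : Exp SF SR V Q') :
    Exp SF SR V fun N _ p v => Q N p v ∧ Q' N p v := by
  have : #(ULift.{u} Bool) ≤ #V := (mk_le_aleph0).trans (aleph0_le_mk V)
  refine (conj this (Q := fun b => if b.down then Q else Q') ?_).congr ?_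
  · rintro ⟨_ | _⟩
    · exact h'
    · exact h
  · intro N _ p _ v
    simp [ULift.forall, and_comm]

theorem ex (hβ : #β ≤ #V)
    {Q : (N : Type u) → [L.Structure N] → N → (α ⊕ β → N) → Prop} (h : Exp SF SR V Q) :
    Exp SF SR V fun N _ p (v : α → N) => ∃ c : β → N, Q N p (Sum.elim v c) :=
  (h.neg.all hβ).neg.congr fun N _ p _ v => by push Not; rfl

/-- The variable `none` stands for the value of the term. Compound terms are unnested by quantifying
over the values of their arguments; a symbol outside `SF` simply returns the base point. -/
theorem term (t : L.Term α) :
    Exp SF SR V fun N _ _ (v : Option α → N) => t.realize (v ∘ some) = v none := by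
  induction t with
  | var a =>
    exact (atom (.eq (some (some a)) (some none))).congr fun N _ p _ v => Iff.rfl
  | @func n f ts ih =>
    by_cases hf : (⟨n, f⟩ : Σ n, L.Functions n) ∈ SF
    · have hn : #(ULift.{u} (Fin n)) ≤ #V := (mk_le_aleph0).trans (aleph0_le_mk V)
      have h₁ := conj hn fun i => rename (β := Option α ⊕ ULift.{u} (Fin n))
        (fun k => k.elim (.inr i) fun a => .inl (some a)) (ih i.down)
      have h₂ := atom (V := V) (α := Option α ⊕ ULift.{u} (Fin n))
        (.fn (⟨_, hf⟩ : SF) (fun i => some (.inr ⟨i⟩)) (some (.inl none)) : UAtom SF SR _)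
      refine ((h₁.and h₂).ex hn).congr fun N _ p _ v => ?_
      simp only [UAtom.Holds, Function.comp_def, Option.elim, Sum.elim_inr, Sum.elim_inl,
        Term.realize]
      constructor
      · intro h
        exact ⟨fun i => (ts i.down).realize (v ∘ some), fun i => rfl, h⟩
      · rintro ⟨c, hc, h⟩
        rw [← h]
        congr 1
        funext i
        exact hc ⟨i⟩
    · refine (atom (.eq none (some none))).congr fun N _ p hp v => ?_
      simp only [Term.realize, UAtom.Holds, Option.elim]
      rw [hp.fn f hf]

/-- Conjunctions and blocks have size at most `θ = #V`, so they fit into codes. In particular only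
`θ` slots matter, however large the type `α` of free variables is. -/
theorem formula {θ : Cardinal.{u}} (hθ : #V = θ) {φ : InfFormula L α}
    (hφ : MemL (Order.succ θ) (Order.succ θ) φ) :
    Exp SF SR V fun N _ _ (v : α → N) => Realize N φ v := by
  induction hφ with
  | @equal α t t' =>
    have h₁ : #(PUnit.{u + 1}) ≤ #V := (mk_le_aleph0).trans (aleph0_le_mk V)
    have h₂ := fun t : L.Term α => rename (β := α ⊕ PUnit.{u + 1})
      (fun k => k.elim (.inr ⟨⟩) fun a => .inl a) (term (SF := SF) (SR := SR) (V := V) t)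
    refine (((h₂ t).and (h₂ t')).ex h₁).congr fun N _ p _ v => ?_
    simp only [Realize, Function.comp_def, Option.elim, Sum.elim_inr, Sum.elim_inl]
    exact ⟨fun h => ⟨fun _ => t.realize v, rfl, h.symm⟩, fun ⟨c, h, h'⟩ => h.trans h'.symm⟩
  | @rel α n R ts =>
    by_cases hR : (⟨n, R⟩ : Σ n, L.Relations n) ∈ SR
    · have hn : #(ULift.{u} (Fin n)) ≤ #V := (mk_le_aleph0).trans (aleph0_le_mk V)
      have h₁ := conj hn fun i => rename (β := α ⊕ ULift.{u} (Fin n))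
        (fun k => k.elim (.inr i) fun a => .inl a)
        (term (SF := SF) (SR := SR) (V := V) (ts i.down))
      have h₂ := atom (V := V) (α := α ⊕ ULift.{u} (Fin n))
        (.rel (⟨_, hR⟩ : SR) (fun i => some (.inr ⟨i⟩)) : UAtom SF SR _)
      refine ((h₁.and h₂).ex hn).congr fun N _ p _ v => ?_
      simp only [UAtom.Holds, Function.comp_def, Option.elim, Sum.elim_inr, Sum.elim_inl,
        Realize]
      constructor
      · intro h
        exact ⟨fun i => (ts i.down).realize v, fun i => rfl, h⟩
      · rintro ⟨c, hc, h⟩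
        convert h using 2 with i
        exact hc ⟨i⟩
    · refine (atom (.eq none none)).neg.congr fun N _ p hp v => ?_
      simp only [Realize, UAtom.Holds, not_true_eq_false, iff_false]
      exact hp.rel R hR _
  | neg _ ih => exact ih.neg
  | conj hι _ ih => exact conj (hθ ▸ Order.lt_succ_iff.1 hι) ih
  | all hβ _ ih => exact all (hθ ▸ Order.lt_succ_iff.1 hβ) ih

end Exp

/-! ### Downward Löwenheim–Skolem -/

/-- Closure of a set under operations of arity `V`. -/
theorem exists_closed {N V J : Type u} {c : Cardinal.{u}} (hc : ℵ₀ ≤ c) (hcV : c ^ #V ≤ c)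
    (op : J → (V → N) → N) (hJ : #J ≤ c) (X : Set N) (hX : #X ≤ c) :
    ∃ H : Set N, X ⊆ H ∧ #H ≤ c ∧ ∀ j v, (∀ k, v k ∈ H) → op j v ∈ H := by
  let β : X ⊕ J → Type u := Sum.elim (fun _ => PEmpty) fun _ => V
  let ev : WType β → N := WType.elim N fun x => match x with
    | ⟨.inl x, _⟩ => x.1
    | ⟨.inr j, v⟩ => op j v
  refine ⟨Set.range ev, fun x hx => ⟨.mk (.inl ⟨x, hx⟩) PEmpty.elim, rfl⟩, ?_, ?_⟩
  · refine mk_range_le.trans (mk_wType_le hc hcV ?_ ?_)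
    · rw [mk_sum, lift_id, lift_id]
      exact add_le_of_le hc hX hJ
    · rintro (x | j) <;> simp [β]
  · intro j v hv
    choose t ht using hv
    exact ⟨.mk (.inr j) t, congrArg (op j) (funext ht)⟩

/-- A trivial structure has small `L_{θ⁺ θ⁺}`-elementary substructures containing a given set. -/
theorem exists_elementary_substructure {θ c : Cardinal.{u}} (hθ : ℵ₀ ≤ θ) (hθc : θ ≤ c)
    (hc : c ^ θ ≤ c) (hF : #SF ≤ θ) (hR : #SR ≤ θ) {N : Type u} [L.Structure N] {p : N}
    (hp : IsTriv SF SR N p) (X : Set N) (hX : #X ≤ c) :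
    ∃ T : L.Substructure N, X ⊆ T ∧ #T ≤ c ∧ p ∈ T ∧ IsElementary θ T.subtype := by
  classical
  obtain ⟨V, rfl⟩ : ∃ V : Type u, #V = θ := ⟨θ.out, mk_out θ⟩
  have : Infinite V := infinite_iff.2 hθ
  let W := WForm SF SR V
  have hW : #W ≤ c := WForm.mk_le hF hR hθc hc
  -- The first kind of operation is a Skolem function: one coordinate of a chosen block refuting the
  -- code `node σ w`. The second makes a finitary function `V`-ary by reading the coordinates at
  -- embedded naturals.
  let op : ((V → V ⊕ V) × (V → W) × V) ⊕ SF → (V → N) → N := Sum.elim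
    (fun j v => if h : ∃ d : V → N, ∀ i, (j.2.1 i).Holds (Sum.elim v d ∘ j.1)
      then h.choose j.2.2 else p)
    (fun f v => funMap f.1.2 fun i => v (Infinite.natEmbedding V i))
  have hc₀ := hθ.trans hθc
  obtain ⟨H, hXH, hHc, hH⟩ := exists_closed hc₀ hc op (by
    simp only [mk_sum, mk_prod, lift_id, mk_arrow]
    rw [add_eq_self hθ]
    refine add_le_of_le hc₀ ?_ (hF.trans hθc)
    refine (mul_le_mul' ((power_le_power_right hθc).trans hc)
      (mul_le_mul' ((power_le_power_right hW).trans hc) hθc)).trans ?_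
    rw [mul_eq_self hc₀, mul_eq_self hc₀]) (insert p X) (by
      refine mk_insert_le.trans (add_le_of_le hc₀ hX (one_le_aleph0.trans hc₀)))
  have hpH : p ∈ H := hXH (Set.mem_insert _ _)
  let T : L.Substructure N := ⟨H, fun {n} f x hx => by
    by_cases hf : (⟨n, f⟩ : Σ n, L.Functions n) ∈ SF
    · have := hH (.inr ⟨_, hf⟩)
        (Function.extend (fun i : Fin n => Infinite.natEmbedding V i) x fun _ => p) fun k => by
          rcases em (∃ i : Fin n, Infinite.natEmbedding V i = k) with ⟨i, rfl⟩ | hk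
          · refine Set.mem_of_eq_of_mem (((Infinite.natEmbedding V).injective.comp
              Fin.val_injective).extend_apply _ _ i) (hx i)
          · rw [Function.extend_apply' _ _ _ hk]
            exact hpH
      convert this using 1
      change _ = funMap f _
      congr 1
      funext i
      exact (((Infinite.natEmbedding V).injective.comp Fin.val_injective).extend_apply _ _ i).symm
    · rw [hp.fn f hf]
      exact hpH⟩
  have hT : IsTriv SF SR T ⟨p, hpH⟩ := hp.substructure T hpH
  -- The Tarski–Vaught argument on codes: a refuting block in `N` can be taken to be the chosen one,
  -- all of whose coordinates lie in `H`.
  have key : ∀ (w : W) (v : V → T), w.Holds (T.subtype ∘ v) ↔ w.Holds v := by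
    intro w
    induction w with
    | atom a => exact fun v => UAtom.holds_embedding T.subtype v a
    | node σ ws ih =>
      intro v
      have e : ∀ c : V → T, Sum.elim (T.subtype ∘ v) (T.subtype ∘ c) ∘ σ =
          T.subtype ∘ (Sum.elim v c ∘ σ) := fun c => by
        rw [← Sum.comp_elim, Function.comp_assoc]
      simp only [WForm.Holds]
      constructor
      · intro h d
        obtain ⟨i, hi⟩ := h (T.subtype ∘ d)
        refine ⟨i, ?_⟩
        rwa [e, ih] at hi
      · intro h
        by_contra! hd
        have hmem : ∀ i, hd.choose i ∈ H := fun i => by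
          have := hH (.inl (σ, ws, i)) (T.subtype ∘ v) fun k => (v k).2
          simp only [op, Sum.elim_inl, dif_pos hd] at this
          exact this
        obtain ⟨i, hi⟩ := h fun i => ⟨hd.choose i, hmem i⟩
        refine hi ?_
        rw [← ih, ← e]
        exact hd.choose_spec i
  refine ⟨T, (Set.subset_insert _ _).trans hXH, hHc, hpH, fun α φ hφ v => ?_⟩
  obtain ⟨w, s, h⟩ := Exp.formula (SF := SF) (SR := SR) (V := V) rfl hφ
  refine (h T _ hT v).trans (Iff.trans ?_ (h N _ hp _).symm)
  rw [← key]
  refine iff_of_eq (congrArg _ (funext fun k => ?_))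
  simp only [Function.comp_apply]
  cases s k <;> rfl

end

/-! ### Good diagrams and the covering argument -/

section

variable {L : FirstOrder.Language.{u, u}}
variable {SF : Set (Σ n, L.Functions n)} {SR : Set (Σ n, L.Relations n)} {Λ : Type u}

/-- The sentence `φ` is invariant under unions of `≺_{θ⁺ θ⁺}`-elementary chains. -/
def UnionInvariant (θ : Cardinal.{u}) (φ : InfFormula L PEmpty.{u + 1}) : Prop :=
  ∀ (M : Type u) [L.Structure M] [Nonempty M] (S : ℕ → L.Substructure M) [∀ n, Nonempty (S n)]
    (hS : Monotone S), (∀ x : M, ∃ n, x ∈ S n) →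
    (∀ n, IsElementary θ (Substructure.inclusion (hS (Nat.le_succ n)))) →
    ∀ n, Realize (S n) φ PEmpty.elim ↔ Realize M φ PEmpty.elim

/-- Invariance is an equivalence at every stage of the chain; this is what handles the complement of
the class. -/
theorem UnionInvariant.neg {θ : Cardinal.{u}} {φ : InfFormula L PEmpty.{u + 1}}
    (h : UnionInvariant θ φ) : UnionInvariant θ φ.neg :=
  fun M _ _ S _ hS hx he n => not_congr (h M S hS hx he n)

theorem realize_sentence_equiv {M N : Type u} [L.Structure M] [L.Structure N] (e : M ≃[L] N)
    (φ : InfFormula L PEmpty.{u + 1}) :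
    Realize N φ PEmpty.elim ↔ Realize M φ PEmpty.elim := by
  rw [← realize_equiv e, Subsingleton.elim (e ∘ PEmpty.elim) PEmpty.elim]

/-- The union invariance, for a chain of substructures whose union is a substructure `U`. -/
theorem UnionInvariant.realize_iff {θ : Cardinal.{u}} {φ : InfFormula L PEmpty.{u + 1}}
    (h : UnionInvariant θ φ) {N : Type u} [L.Structure N] (T : ℕ → L.Substructure N)
    [∀ n, Nonempty (T n)] (hT : Monotone T) (U : L.Substructure N)
    (hU : ∀ x, x ∈ U ↔ ∃ n, x ∈ T n)
    (hel : ∀ n, IsElementary θ (Substructure.inclusion (hT (Nat.le_succ n)))) (n : ℕ) :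
    Realize (T n) φ PEmpty.elim ↔ Realize U φ PEmpty.elim := by
  have hTU : ∀ n, T n ≤ U := fun n x hx => (hU x).2 ⟨n, hx⟩
  -- Invariance speaks of chains exhausting the whole structure, so the chain is moved inside `U`.
  let S : ℕ → L.Substructure U := fun n => (T n).comap U.subtype.toHom
  have hS : Monotone S := fun m n hmn x hx => hT hmn hx
  let e : ∀ n, S n ≃[L] T n := fun n =>
    { toFun := fun x => ⟨x.1.1, x.2⟩
      invFun := fun x => ⟨⟨x.1, hTU n x.2⟩, x.2⟩
      left_inv := fun _ => rfl
      right_inv := fun _ => rfl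
      map_fun' := fun _ _ => rfl
      map_rel' := fun _ _ => Iff.rfl }
  have hne : ∀ n, Nonempty (S n) := fun n => (e n).toEquiv.nonempty
  have : Nonempty U := (hne 0).map fun x => x.1
  rw [realize_sentence_equiv (e n)]
  refine h U S hS (fun x => (hU x.1).1 x.2) (fun n α ψ hψ v => ?_) n
  rw [← realize_equiv (e n), ← realize_equiv (e (n + 1)), hel n α ψ hψ]
  rfl

/-- `v` enumerates an elementary substructure, with the base point `p` at `i₀`. -/
def IsIndex (θ : Cardinal.{u}) {N : Type u} [L.Structure N] (p : N) (i₀ : Λ) (v : Λ → N) : Prop :=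
  v i₀ = p ∧ ∃ T : L.Substructure N, (T : Set N) = Set.range v ∧ IsElementary θ T.subtype

variable (SF SR) in
/-- The unnested diagrams of pairs of enumerated elementary substructures of models of `φ`. -/
def GoodDiagram (θ : Cardinal.{u}) (φ : InfFormula L PEmpty.{u + 1}) (i₀ : Λ)
    (d : Set (UAtom SF SR (Λ ⊕ Λ))) : Prop :=
  ∃ (N : Type u) (_ : L.Structure N) (p : N) (v w : Λ → N), IsTriv SF SR N p ∧
    Realize N φ PEmpty.elim ∧ IsIndex (L := L) θ p i₀ v ∧
    IsIndex (L := L) θ p i₀ w ∧ d = {a | a.Holds (Sum.elim v w)}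

/-- Closure of the range of `v` under symbols of `SF` is read off the diagram, since the range of
`w` is closed; the remaining symbols return `p = v i₀`. -/
theorem exists_substructure_of_diagram {N N' : Type u} [L.Structure N] [L.Structure N'] {p : N}
    {p' : N'} (h : IsTriv SF SR N p) (h' : IsTriv SF SR N' p') {A : Type u} {v : A → N} {w : A → N'}
    (i₀ : A) (hv₀ : v i₀ = p) (hw₀ : w i₀ = p') (hd : ∀ a : UAtom SF SR A, a.Holds v ↔ a.Holds w)
    (T' : L.Substructure N') (hT' : (T' : Set N') = Set.range w) (lam mu : Cardinal.{u}) :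
    ∃ T : L.Substructure N, (T : Set N) = Set.range v ∧
      ∀ {α : Type u} (φ : InfFormula L α), MemL lam mu φ → ∀ (s : α → A) (x : α → T) (y : α → T'),
        (∀ a, (x a : N) = v (s a)) → (∀ a, (y a : N') = w (s a)) →
        (Realize T φ x ↔ Realize T' φ y) := by
  let T : L.Substructure N := ⟨Set.range v, fun {n} f x hx => by
    choose s hs using hx
    obtain rfl : v ∘ s = x := funext hs
    by_cases hf : (⟨n, f⟩ : Σ n, L.Functions n) ∈ SF
    · have : funMap f (w ∘ s) ∈ (T' : Set N') := T'.fun_mem f _ fun i => by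
        change _ ∈ (T' : Set N')
        rw [hT']
        exact ⟨s i, rfl⟩
      rw [hT'] at this
      obtain ⟨j, hj⟩ := this
      exact ⟨j, ((hd (.fn ⟨_, hf⟩ s j)).2 hj.symm).symm⟩
    · rw [h.fn f hf]
      exact ⟨i₀, hv₀⟩⟩
  refine ⟨T, rfl, fun {α} φ hφ s x y hx hy => ?_⟩
  have hwT : ∀ i, w i ∈ T' := fun i => by
    change _ ∈ (T' : Set N')
    rw [hT']
    exact ⟨i, rfl⟩
  let v₁ : A → T := fun i => ⟨v i, i, rfl⟩
  let w₁ : A → T' := fun i => ⟨w i, hwT i⟩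
  obtain rfl : v₁ ∘ s = x := funext fun a => Subtype.ext (hx a).symm
  obtain rfl : w₁ ∘ s = y := funext fun a => Subtype.ext (hy a).symm
  refine realize_iff_of_diagram (h.substructure T ⟨i₀, hv₀⟩)
    (h'.substructure T' (hw₀ ▸ hwT i₀)) ?_ ?_ i₀ (Subtype.ext hv₀) (Subtype.ext hw₀) ?_ hφ s
  · rintro ⟨_, i, rfl⟩
    exact ⟨i, rfl⟩
  · rintro ⟨z, hz⟩
    have : z ∈ (T' : Set N') := hz
    rw [hT'] at this
    obtain ⟨i, rfl⟩ := this
    exact ⟨i, rfl⟩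
  · intro a
    rw [← UAtom.holds_embedding T.subtype v₁, ← UAtom.holds_embedding T'.subtype w₁]
    exact hd a

/-- A good diagram describes a pair of substructures satisfying `φ`, and if the first is contained
in the second, then it is an elementary substructure. -/
theorem GoodDiagram.exists_substructures {θ : Cardinal.{u}} {φ : InfFormula L PEmpty.{u + 1}}
    (hφ : MemL (Order.succ θ) (Order.succ θ) φ) {i₀ : Λ} {N : Type u} [L.Structure N] {p : N}
    (hN : IsTriv SF SR N p) {v w : Λ → N} (hv : v i₀ = p) (hw : w i₀ = p)
    (hd : GoodDiagram SF SR θ φ i₀ {a | a.Holds (Sum.elim v w)}) :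
    ∃ T U : L.Substructure N, (T : Set N) = Set.range v ∧ (U : Set N) = Set.range w ∧
      Realize T φ PEmpty.elim ∧ ∀ h : T ≤ U, IsElementary θ (Substructure.inclusion h) := by
  obtain ⟨N', _, p', v', w', hN', hφ', ⟨hv', T', hT', hTel⟩, ⟨hw', U', hU', hUel⟩, hd⟩ := hd
  have hd : ∀ a : UAtom SF SR (Λ ⊕ Λ), a.Holds (Sum.elim v w) ↔ a.Holds (Sum.elim v' w') :=
    fun a => Set.ext_iff.1 hd a
  obtain ⟨T, hT, hTT'⟩ := exists_substructure_of_diagram (v := v) hN hN' i₀ hv hv' (fun a => by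
    simpa [UAtom.holds_map] using hd (a.map Sum.inl)) T' hT' (Order.succ θ) (Order.succ θ)
  obtain ⟨U, hU, hUU'⟩ := exists_substructure_of_diagram (v := w) hN hN' i₀ hw hw' (fun a => by
    simpa [UAtom.holds_map] using hd (a.map Sum.inr)) U' hU' (Order.succ θ) (Order.succ θ)
  refine ⟨T, U, hT, hU, ?_, fun h α ψ hψ x => ?_⟩
  · rw [hTT' φ hφ PEmpty.elim _ PEmpty.elim (fun a => a.elim) (fun a => a.elim), hTel _ _ hφ,
      Subsingleton.elim (T'.subtype ∘ PEmpty.elim) PEmpty.elim]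
    exact hφ'
  · have hx : ∀ a, ∃ i, v i = x a := fun a => by
      have : (x a : N) ∈ (T : Set N) := (x a).2
      rwa [hT] at this
    choose s hs using hx
    have hxU : ∀ a, ∃ i, w i = x a := fun a => by
      have : (x a : N) ∈ (U : Set N) := h (x a).2
      rwa [hU] at this
    choose t ht using hxU
    -- The equality atoms of the joint diagram record that the element `x a` has both indices, so
    -- the two copies of the assignment agree in `N'`, where both substructures are elementary.
    have hst : ∀ a, v' (s a) = w' (t a) := fun a =>
      (hd (.eq (.inl (s a)) (.inr (t a)))).1 ((hs a).trans (ht a).symm)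
    have hvT' : ∀ i, v' i ∈ T' := fun i => by
      change _ ∈ (T' : Set N')
      rw [hT']
      exact ⟨i, rfl⟩
    have hwU' : ∀ i, w' i ∈ U' := fun i => by
      change _ ∈ (U' : Set N')
      rw [hU']
      exact ⟨i, rfl⟩
    rw [hTT' ψ hψ s x (fun a => ⟨v' (s a), hvT' _⟩) (fun a => (hs a).symm) fun _ => rfl,
      hUU' ψ hψ t _ (fun a => ⟨w' (t a), hwU' _⟩) (fun a => (ht a).symm) fun _ => rfl,
      hTel _ _ hψ, hUel _ _ hψ]
    exact iff_of_eq (congrArg _ (funext hst))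

/-- If a trivial structure is covered, in the sense of the covering sentence, by a directed system
of small substructures with good diagrams, then it satisfies `φ`. -/
theorem realize_of_covering {θ : Cardinal.{u}} (hθ : ℵ₀ ≤ θ) (hθΛ : θ ≤ #Λ) (hΛ : #Λ ^ θ ≤ #Λ)
    {φ : InfFormula L PEmpty.{u + 1}} (hφ : MemL (Order.succ θ) (Order.succ θ) φ)
    (hφU : UnionInvariant θ φ) (hF : #SF ≤ θ) (hR : #SR ≤ θ) {N : Type u} [L.Structure N] {p : N}
    (hN : IsTriv SF SR N p) {i₀ : Λ} {I : Type u} [Nonempty I] (G : I → Λ → N)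
    (hG : ∀ a, G a i₀ = p)
    (hgood : ∀ a b, GoodDiagram SF SR θ φ i₀ {x | x.Holds (Sum.elim (G a) (G b))})
    (hdir : ∀ a b, ∃ c, Set.range (G a) ⊆ Set.range (G c) ∧ Set.range (G b) ⊆ Set.range (G c))
    (hcov : ∀ x : Λ → N, ∃ a : ℕ → I, ∀ i, ∃ n, x i ∈ Set.range (G (a n))) :
    Realize N φ PEmpty.elim := by
  have hΛ₀ := hθ.trans hθΛ
  have hsub := fun a b => (hgood a b).exists_substructures hφ hN (hG a) (hG b)
  have hR' : ∀ a, ∃ T : L.Substructure N, (T : Set N) = Set.range (G a) := fun a =>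
    let ⟨T, _, hT, _⟩ := hsub a a
    ⟨T, hT⟩
  choose R hRG using hR'
  have hRφ : ∀ a, Realize (R a) φ PEmpty.elim := fun a => by
    obtain ⟨T, _, hT, _, h, _⟩ := hsub a a
    obtain rfl : T = R a := SetLike.coe_injective (hT.trans (hRG a).symm)
    exact h
  have hRel : ∀ a b (h : R a ≤ R b), IsElementary θ (Substructure.inclusion h) := fun a b => by
    obtain ⟨T, U, hT, hU, _, h⟩ := hsub a b
    obtain rfl : T = R a := SetLike.coe_injective (hT.trans (hRG a).symm)
    obtain rfl : U = R b := SetLike.coe_injective (hU.trans (hRG b).symm)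
    exact h
  have hdir' : ∀ a b, ∃ c, R a ≤ R c ∧ R b ≤ R c := fun a b => by
    obtain ⟨c, h₁, h₂⟩ := hdir a b
    rw [← hRG, ← hRG] at h₁ h₂
    exact ⟨c, h₁, h₂⟩
  choose j hj₁ hj₂ using hdir'
  have hpR : ∀ a, p ∈ R a := fun a => by
    change p ∈ (R a : Set N)
    rw [hRG]
    exact ⟨i₀, hG a⟩
  -- Countably many ranges have a union of size at most `#Λ`, so Löwenheim–Skolem absorbs them.
  have hT : ∀ D : {D : Set I // D.Countable}, ∃ T : L.Substructure N, (∀ a ∈ D.1, R a ≤ T) ∧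
      #T ≤ #Λ ∧ p ∈ T ∧ IsElementary θ T.subtype := fun D => by
    obtain ⟨T, hT, h⟩ := exists_elementary_substructure hθ hθΛ hΛ hF hR hN
      (⋃ a : D.1, Set.range (G a)) (by
        have := D.2.to_subtype
        refine mk_iUnion_le_sum_mk.trans ((sum_le_sum _ (fun _ => #Λ) fun a => mk_range_le).trans ?_)
        rw [sum_const']
        exact (mul_le_mul' (mk_le_aleph0.trans hΛ₀) le_rfl).trans (mul_eq_self hΛ₀).le)
    refine ⟨T, fun a ha x hx => hT ?_, h⟩
    have hx : x ∈ (R a : Set N) := hx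
    rw [hRG] at hx
    exact Set.mem_iUnion.2 ⟨⟨a, ha⟩, hx⟩
  choose T hDT hTΛ hpT hTel using hT
  have hC : ∀ D, ∃ C : Set I, C.Countable ∧ ∀ x ∈ T D, ∃ a ∈ C, x ∈ R a := fun D => by
    have : Nonempty (T D) := ⟨⟨p, hpT D⟩⟩
    obtain ⟨f⟩ := hTΛ D
    obtain ⟨a, ha⟩ := hcov fun i => (Function.invFun (f : T D → Λ) i).1
    refine ⟨Set.range a, Set.countable_range a, fun x hx => ?_⟩
    obtain ⟨n, hn⟩ := ha (f ⟨x, hx⟩)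
    rw [Function.leftInverse_invFun f.injective, ← hRG] at hn
    exact ⟨a n, ⟨n, rfl⟩, hn⟩
  choose C hCc hC using hC
  obtain ⟨a₀⟩ : Nonempty I := inferInstance
  -- Each stage adds countably many indices covering the previous `T (D n)`, and upper bounds for
  -- pairs. The limit is a countable directed set of indices whose ranges have the same union as the
  -- `T (D n)`.
  let D : ℕ → {D : Set I // D.Countable} := fun n => Nat.rec ⟨{a₀}, Set.countable_singleton _⟩
    (fun _ D => ⟨D.1 ∪ C D ∪ Set.image2 j D.1 D.1,
      (D.2.union (hCc D)).union (D.2.image2 D.2 j)⟩) n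
  have hDsucc : ∀ n, (D (n + 1)).1 = (D n).1 ∪ C (D n) ∪ Set.image2 j (D n).1 (D n).1 :=
    fun _ => rfl
  have hDmono : Monotone fun n => (D n).1 := monotone_nat_of_le_succ fun n => by
    rw [hDsucc]
    exact Set.subset_union_left.trans Set.subset_union_left
  have hCD : ∀ n, C (D n) ⊆ (D (n + 1)).1 := fun n => by
    rw [hDsucc]
    exact Set.subset_union_right.trans Set.subset_union_left
  have hTmono : Monotone fun n => T (D n) := monotone_nat_of_le_succ fun n x hx => by
    obtain ⟨a, ha, hxa⟩ := hC (D n) x hx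
    exact hDT _ a (hCD n ha) hxa
  have : ∀ n, Nonempty (T (D n)) := fun n => ⟨⟨p, hpT _⟩⟩
  let U : L.Substructure N := ⨆ n, T (D n)
  have hU : ∀ x, x ∈ U ↔ ∃ n, x ∈ T (D n) := fun x =>
    Substructure.mem_iSup_of_directed hTmono.directed_le
  have hUT : Realize (T (D 0)) φ PEmpty.elim ↔ Realize U φ PEmpty.elim := by
    refine hφU.realize_iff (fun n => T (D n)) hTmono U hU (fun n α ψ hψ v => ?_) 0
    rw [hTel _ _ _ hψ, hTel _ _ _ hψ]
    rfl
  obtain ⟨d, hd⟩ := (Set.countable_iUnion fun n => (D n).2).exists_eq_range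
    ⟨a₀, Set.mem_iUnion.2 ⟨0, rfl⟩⟩
  -- An `ω`-chain cofinal in the countable directed family enumerated by `d`.
  let b : ℕ → I := fun n => Nat.rec (d 0) (fun n a => j a (d (n + 1))) n
  have hbD : ∀ n, b n ∈ ⋃ n, (D n).1 := fun n => by
    induction n with
    | zero => exact hd ▸ ⟨0, rfl⟩
    | succ n ih =>
      have h₁ : d (n + 1) ∈ ⋃ n, (D n).1 := hd ▸ ⟨n + 1, rfl⟩
      obtain ⟨k, hk⟩ := Set.mem_iUnion.1 ih
      obtain ⟨l, hl⟩ := Set.mem_iUnion.1 h₁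
      refine Set.mem_iUnion.2 ⟨max k l + 1, ?_⟩
      rw [hDsucc]
      exact .inr ⟨_, hDmono (le_max_left k l) hk, _, hDmono (le_max_right k l) hl, rfl⟩
  have hdb : ∀ n, R (d n) ≤ R (b n) := fun n => by
    cases n with
    | zero => exact le_rfl
    | succ n => exact hj₂ _ _
  have hbmono : Monotone fun n => R (b n) := monotone_nat_of_le_succ fun n => hj₁ _ _
  have : ∀ n, Nonempty (R (b n)) := fun n => ⟨⟨p, hpR _⟩⟩
  have hUR : Realize (R (b 0)) φ PEmpty.elim ↔ Realize U φ PEmpty.elim := by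
    refine hφU.realize_iff (fun n => R (b n)) hbmono U (fun x => ?_) (fun n => hRel _ _ _) 0
    rw [hU]
    constructor
    · rintro ⟨n, hn⟩
      obtain ⟨a, ha, hxa⟩ := hC (D n) x hn
      have : a ∈ Set.range d := hd ▸ Set.mem_iUnion.2 ⟨n + 1, hCD n ha⟩
      obtain ⟨k, rfl⟩ := this
      exact ⟨k, hdb k hxa⟩
    · rintro ⟨n, hn⟩
      obtain ⟨k, hk⟩ := Set.mem_iUnion.1 (hbD n)
      exact ⟨k, hDT _ _ hk hn⟩
  have := hUT.2 (hUR.1 (hRφ _))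
  rw [hTel _ _ _ hφ, Subsingleton.elim (_ ∘ PEmpty.elim) PEmpty.elim] at this
  exact this

/-- Every small subset of a trivial structure is contained in the range of an index. -/
theorem exists_isIndex {θ : Cardinal.{u}} (hθ : ℵ₀ ≤ θ) (hθΛ : θ ≤ #Λ) (hΛ : #Λ ^ θ ≤ #Λ)
    (hF : #SF ≤ θ) (hR : #SR ≤ θ) {N : Type u} [L.Structure N] {p : N}
    (hN : IsTriv SF SR N p) (i₀ : Λ) (X : Set N) (hX : #X ≤ #Λ) :
    ∃ v : Λ → N, IsIndex (L := L) θ p i₀ v ∧ X ⊆ Set.range v := by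
  classical
  obtain ⟨T, hXT, hT, hp, hel⟩ := exists_elementary_substructure hθ hθΛ hΛ hF hR hN X hX
  have : Nonempty T := ⟨⟨p, hp⟩⟩
  obtain ⟨f⟩ := hT
  -- The transposition puts the base point at index `i₀`.
  let g : Λ → T := Function.invFun f ∘ Equiv.swap i₀ (f ⟨p, hp⟩)
  have hg : Function.Surjective g :=
    (Function.invFun_surjective f.injective).comp (Equiv.surjective _)
  have hTg : (T : Set N) = Set.range fun i => (g i : N) := by
    ext x
    constructor
    · intro hx
      obtain ⟨i, hi⟩ := hg ⟨x, hx⟩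
      exact ⟨i, congrArg Subtype.val hi⟩
    · rintro ⟨i, rfl⟩
      exact (g i).2
  refine ⟨fun i => g i, ⟨?_, T, hTg, hel⟩, hTg ▸ hXT⟩
  simp only [g, Function.comp_apply, Equiv.swap_apply_left]
  rw [Function.leftInverse_invFun f.injective]

end

/-! ### The coding sentence -/

section

/-- Function symbols `F i`, for `i : Λ`, all unary. -/
inductive CodeFun (Λ : Type u) : ℕ → Type u
  | F (i : Λ) : CodeFun Λ 1

/-- A unary predicate symbol `P`. -/
inductive CodeRel : ℕ → Type u
  | P : CodeRel 1

/-- The vocabulary with unary function symbols `F i`, for `i : Λ`, and a unary predicate `P`. -/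
def codeLang (Λ : Type u) : FirstOrder.Language.{u, u} := ⟨CodeFun Λ, CodeRel⟩

variable {L : FirstOrder.Language.{u, u}}
variable {SF : Set (Σ n, L.Functions n)} {SR : Set (Σ n, L.Relations n)} {Λ α V : Type u}

/-- The symbol `F i`. -/
def codeF (i : Λ) : (codeLang Λ).Functions 1 := CodeFun.F i

/-- The symbol `P`. -/
def codeP (Λ : Type u) : (codeLang Λ).Relations 1 := CodeRel.P

/-- The term `F i t`. -/
def codeTerm (i : Λ) (t : (L.sum (codeLang Λ)).Term α) : (L.sum (codeLang Λ)).Term α :=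
  Functions.apply₁ ((LHom.sumInr : codeLang Λ →ᴸ L.sum (codeLang Λ)).onFunction (codeF i)) t

/-- The formula `P t`. -/
def codePred (t : (L.sum (codeLang Λ)).Term α) : InfFormula (L.sum (codeLang Λ)) α :=
  .rel ((LHom.sumInr : codeLang Λ →ᴸ L.sum (codeLang Λ)).onRelation (codeP Λ)) ![t]

/-- An unnested atomic formula as an infinitary formula, with terms substituted for variables. -/
def UAtom.toFormula (t : V → (L.sum (codeLang Λ)).Term α) :
    UAtom SF SR V → InfFormula (L.sum (codeLang Λ)) α
  | eq x y => .equal (t x) (t y)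
  | fn f x y => .equal (.func ((LHom.sumInl : L →ᴸ L.sum (codeLang Λ)).onFunction f.1.2) (t ∘ x)) (t y)
  | rel r x => .rel ((LHom.sumInl : L →ᴸ L.sum (codeLang Λ)).onRelation r.1.2) (t ∘ x)

section Realize

variable (M : Type u) [L.Structure M] [(codeLang Λ).Structure M]

theorem realize_codeTerm (i : Λ) (t : (L.sum (codeLang Λ)).Term α) (v : α → M) :
    (codeTerm i t).realize v = funMap (codeF i) ![t.realize v] := by
  rw [codeTerm, Term.realize_functions_apply₁]
  rfl

theorem realize_codePred (t : (L.sum (codeLang Λ)).Term α) (v : α → M) :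
    Realize M (codePred t) v ↔ RelMap (codeP Λ) ![t.realize v] := by
  have : (fun i => (![t] i).realize v) = ![t.realize v] := by
    funext i
    simp
  simp only [codePred, Realize, this]
  rfl

theorem UAtom.realize_toFormula (t : V → (L.sum (codeLang Λ)).Term α) (a : UAtom SF SR V)
    (v : α → M) : Realize M (a.toFormula t) v ↔ a.Holds fun k => (t k).realize v := by
  cases a <;> rfl

end Realize

namespace InfFormula

theorem MemL.disj {lam mu : Cardinal.{u}} {ι : Type u} {φ : ι → InfFormula L α}
    (hι : #ι < lam) (h : ∀ i, MemL lam mu (φ i)) : MemL lam mu (disj φ) :=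
  .neg (.conj hι fun i => .neg (h i))

theorem MemL.ex {lam mu : Cardinal.{u}} {β : Type u} {φ : InfFormula L (α ⊕ β)} (hβ : #β < mu)
    (h : MemL lam mu φ) : MemL lam mu (ex φ) :=
  .neg (.all hβ (.neg h))

theorem MemL.toFormula {lam mu : Cardinal.{u}} (t : V → (L.sum (codeLang Λ)).Term α)
    (a : UAtom SF SR V) : MemL lam mu (a.toFormula t) := by
  cases a
  · exact .equal _ _
  · exact .equal _ _
  · exact .rel _ _

end InfFormula

variable (L Λ) in
/-- The terms `F i x` and `F i y`. -/
def pairTerm : Λ ⊕ Λ → (L.sum (codeLang Λ)).Term (PEmpty.{u + 1} ⊕ ULift.{u} Bool) :=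
  Sum.elim (fun i => codeTerm i (.var (.inr ⟨true⟩))) fun i => codeTerm i (.var (.inr ⟨false⟩))

open Classical in
/-- The pair of families of terms has a diagram in `D`. -/
noncomputable def diagramSentence (D : Set (Set (UAtom SF SR (Λ ⊕ Λ)))) :
    InfFormula (L.sum (codeLang Λ)) PEmpty.{u + 1} :=
  .all (β := ULift.{u} Bool) <| disj fun d : D => .conj fun a : UAtom SF SR (Λ ⊕ Λ : Type u) =>
    if a ∈ d.1 then a.toFormula (pairTerm L Λ) else (a.toFormula (pairTerm L Λ)).neg

variable (L Λ) in
/-- All values of the functions `F i` are in `P`. -/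
def predSentence : InfFormula (L.sum (codeLang Λ)) PEmpty.{u + 1} :=
  .all (β := PUnit.{u + 1}) <| .conj fun i : Λ => codePred (codeTerm i (.var (.inr ⟨⟩)))

variable (L Λ) in
/-- The family of the sets `{F i a | i : Λ}` is directed. -/
def directedSentence : InfFormula (L.sum (codeLang Λ)) PEmpty.{u + 1} :=
  .all (β := ULift.{u} Bool) <| ex (β := PUnit.{u + 1}) <| .conj fun b : ULift.{u} Bool =>
    .conj fun i : Λ => disj fun j : Λ =>
      .equal (codeTerm i (.var (.inl (.inr b)))) (codeTerm j (.var (.inr ⟨⟩)))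

variable (L Λ) in
/-- Every `Λ`-sequence in `P` is covered by countably many sets of the form `{F i a | i : Λ}`. -/
def coverSentence : InfFormula (L.sum (codeLang Λ)) PEmpty.{u + 1} :=
  .split (X := Λ) fun A => ex (β := PUnit.{u + 1}) <| .conj fun i : A => disj fun o : Option Λ =>
    -- The extra disjunct `none` exempts entries of the sequence outside `P`.
    o.elim (codePred (.var (.inl (.inr i)))).neg
      fun j => .equal (.var (.inl (.inr i))) (codeTerm j (.var (.inr ⟨⟩)))

/-- The conjunction of the above sentences. -/
noncomputable def codingSentence (D : Set (Set (UAtom SF SR (Λ ⊕ Λ)))) :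
    InfFormula (L.sum (codeLang Λ)) PEmpty.{u + 1} :=
  .conj fun b : ULift.{u} (Fin 4) =>
    ![predSentence L Λ, diagramSentence D, directedSentence L Λ, coverSentence L Λ] b.down

theorem realize_codingSentence (D : Set (Set (UAtom SF SR (Λ ⊕ Λ)))) (M : Type u) [L.Structure M]
    [(codeLang Λ).Structure M] :
    Realize M (codingSentence D) PEmpty.elim ↔
      (∀ (a : M) (i : Λ), RelMap (codeP Λ) ![funMap (codeF i) ![a] ]) ∧
      (∀ a b : M, {x : UAtom SF SR (Λ ⊕ Λ) | x.Holds (Sum.elim (fun i => funMap (codeF i) ![a])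
        fun i => funMap (codeF i) ![b])} ∈ D) ∧
      (∀ a b : M, ∃ c : M, (∀ i : Λ, ∃ j : Λ, funMap (codeF i) ![a] = funMap (codeF j) ![c]) ∧
        ∀ i : Λ, ∃ j : Λ, funMap (codeF i) ![b] = funMap (codeF j) ![c]) ∧
      ∀ x : Λ → M, ∃ f : Λ → ℕ, ∀ n, ∃ a : M, ∀ i, f i = n →
        RelMap (codeP Λ) ![x i] → ∃ j : Λ, x i = funMap (codeF j) ![a] := by
  have h₁ : Realize M (predSentence L Λ) PEmpty.elim ↔
      ∀ (a : M) (i : Λ), RelMap (codeP Λ) ![funMap (codeF i) ![a] ] := by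
    simp only [predSentence, Realize, realize_codePred, realize_codeTerm, Term.realize,
      Sum.elim_inr]
    exact ⟨fun h a => h fun _ => a, fun h c => h _⟩
  have h₂ : Realize M (diagramSentence D) PEmpty.elim ↔
      ∀ a b : M, {x : UAtom SF SR (Λ ⊕ Λ) | x.Holds (Sum.elim (fun i => funMap (codeF i) ![a])
        fun i => funMap (codeF i) ![b])} ∈ D := by
    have key : ∀ c : ULift.{u} Bool → M, (fun k => (pairTerm L Λ k).realize
        (Sum.elim (PEmpty.elim : PEmpty.{u + 1} → M) c)) =
        Sum.elim (fun i => funMap (codeF i) ![c ⟨true⟩])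
          (fun i => funMap (codeF i) ![c ⟨false⟩]) := by
      intro c
      funext k
      rcases k with i | i <;>
        simp only [pairTerm, Sum.elim_inl, Sum.elim_inr, realize_codeTerm, Term.realize]
    have key₂ : ∀ c : ULift.{u} Bool → M, Realize M
        (disj fun d : D => .conj fun a : UAtom SF SR (Λ ⊕ Λ : Type u) =>
          open Classical in
          if a ∈ d.1 then a.toFormula (pairTerm L Λ) else (a.toFormula (pairTerm L Λ)).neg)
        (Sum.elim (PEmpty.elim : PEmpty.{u + 1} → M) c) ↔
        {x : UAtom SF SR (Λ ⊕ Λ) | x.Holds (Sum.elim (fun i => funMap (codeF i) ![c ⟨true⟩])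
          fun i => funMap (codeF i) ![c ⟨false⟩])} ∈ D := fun c => by
      rw [realize_disj]
      simp only [Realize]
      rw [← key c]
      constructor
      · rintro ⟨d, hd⟩
        convert d.2
        ext a
        have := hd a
        split_ifs at this with h
        · exact iff_of_true ((UAtom.realize_toFormula M _ _ _).1 this) h
        · exact iff_of_false (fun h' => this ((UAtom.realize_toFormula M _ _ _).2 h')) h
      · intro h
        refine ⟨⟨_, h⟩, fun a => ?_⟩
        split_ifs with h
        · exact (UAtom.realize_toFormula M _ _ _).2 h
        · exact fun h' => h ((UAtom.realize_toFormula M _ _ _).1 h')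
    simp only [diagramSentence, Realize, key₂]
    exact ⟨fun h a b => h fun i => bif i.down then a else b, fun h c => h _ _⟩
  have h₃ : Realize M (directedSentence L Λ) PEmpty.elim ↔
      ∀ a b : M, ∃ c : M, (∀ i : Λ, ∃ j : Λ, funMap (codeF i) ![a] = funMap (codeF j) ![c]) ∧
        ∀ i : Λ, ∃ j : Λ, funMap (codeF i) ![b] = funMap (codeF j) ![c] := by
    simp only [directedSentence, Realize, realize_ex, realize_disj, realize_codeTerm, Term.realize,
      Sum.elim_inr, Sum.elim_inl]
    constructor
    · intro h a b
      obtain ⟨c, hc⟩ := h fun i => bif i.down then a else b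
      exact ⟨c ⟨⟩, hc ⟨true⟩, hc ⟨false⟩⟩
    · intro h c
      obtain ⟨d, hd, hd'⟩ := h (c ⟨true⟩) (c ⟨false⟩)
      refine ⟨fun _ => d, ?_⟩
      rintro ⟨_ | _⟩
      · exact hd'
      · exact hd
  have h₄ : Realize M (coverSentence L Λ) PEmpty.elim ↔
      ∀ x : Λ → M, ∃ f : Λ → ℕ, ∀ n, ∃ a : M, ∀ i, f i = n →
        RelMap (codeP Λ) ![x i] → ∃ j : Λ, x i = funMap (codeF j) ![a] := by
    simp only [coverSentence, Realize, realize_ex, realize_disj, Option.exists, Option.elim,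
      realize_codePred, realize_codeTerm, Term.realize, Sum.elim_inr, Sum.elim_inl]
    refine forall_congr' fun x => exists_congr fun f => forall_congr' fun n => ?_
    constructor
    · rintro ⟨a, ha⟩
      exact ⟨a ⟨⟩, fun i hi hP => (ha ⟨i, hi⟩).resolve_left fun h => h hP⟩
    · rintro ⟨a, ha⟩
      exact ⟨fun _ => a, fun i => or_iff_not_imp_left.2 fun h => ha i i.2 (not_not.1 h)⟩
  rw [← h₁, ← h₂, ← h₃, ← h₄]
  simp only [codingSentence, Realize, ULift.forall]
  simp only [Fin.forall_fin_succ]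
  simp

/-- Every conjunct but the covering one already lies in `L_{Θ⁺ω}`: although they speak of
`Λ`-sequences, these are named by terms in one or two variables. -/
theorem memL1c_codingSentence {Θ : Cardinal.{u}} (hΘ : ℵ₀ ≤ Θ) (hΛ : #Λ ≤ Θ)
    (hA : #(UAtom SF SR (Λ ⊕ Λ)) ≤ Θ) (D : Set (Set (UAtom SF SR (Λ ⊕ Λ)))) (hD : #D ≤ Θ) :
    MemL1c Θ Θ (codingSentence D) := by
  have hB : #(ULift.{u} Bool) < ℵ₀ := mk_lt_aleph0
  have hU : #(PUnit.{u + 1}) < ℵ₀ := mk_lt_aleph0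
  have hE : #(PEmpty.{u + 1}) ≤ Θ := by simp
  refine .conj (mk_le_aleph0.trans hΘ) hE ?_
  rintro ⟨i⟩
  fin_cases i
  · exact .base (.all hU (.conj (Order.lt_succ_iff.2 hΛ) fun i => .rel _ _))
  · change MemL1c Θ Θ (diagramSentence D)
    refine .base (.all hB (.disj (Order.lt_succ_iff.2 hD) fun d =>
      .conj (Order.lt_succ_iff.2 hA) fun a => ?_))
    split_ifs
    · exact .toFormula _ _
    · exact .neg (.toFormula _ _)
  · exact .base (.all hB (.ex hU (.conj (Order.lt_succ_iff.2 (hB.le.trans hΘ)) fun b =>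
      .conj (Order.lt_succ_iff.2 hΛ) fun i => .disj (Order.lt_succ_iff.2 hΛ) fun j =>
        .equal _ _)))
  · refine .split hΛ hE fun A => .base (.ex hU (.conj (Order.lt_succ_iff.2
      ((mk_set_le A).trans hΛ)) fun i => .disj (Order.lt_succ_iff.2 ?_) fun o => ?_))
    · rw [mk_option]
      exact add_le_of_le hΘ hΛ (one_le_aleph0.trans hΘ)
    · cases o
      · exact .neg (.rel _ _)
      · exact .equal _ _

/-! ### Coding structures and the `Σ` definition -/

/-- The structure `N` with the symbols outside `SF`, `SR` reinterpreted trivially. -/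
def Triv (_SF : Set (Σ n, L.Functions n)) (_SR : Set (Σ n, L.Relations n)) (N : Type u) (_p : N) : Type u := N

open Classical in
noncomputable instance (N : Type u) [L.Structure N] (p : N) : L.Structure (Triv SF SR N p) where
  funMap {n} f x := if (⟨n, f⟩ : Σ n, L.Functions n) ∈ SF then funMap (M := N) f x else p
  RelMap {n} r x := (⟨n, r⟩ : Σ n, L.Relations n) ∈ SR ∧ RelMap (M := N) r x

theorem isTriv_triv (N : Type u) [L.Structure N] (p : N) :
    IsTriv SF SR (Triv SF SR N p) p where
  fn _ hf _ := if_neg hf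
  rel _ hr _ h := hr h.1

theorem UAtom.holds_triv {N : Type u} [L.Structure N] (p : N) (v : V → N) (a : UAtom SF SR V) :
    a.Holds (N := Triv SF SR N p) v ↔ a.Holds v := by
  cases a with
  | eq x y => exact Iff.rfl
  | fn f x y =>
    refine iff_of_eq (congrArg (· = v y) ?_)
    exact if_pos f.2
  | rel r x => exact and_iff_right r.2

/-- Retraction of the coding structure. -/
def codeRetract {N I : Type u} (p : N) : N ⊕ I → N := Sum.elim id fun _ => p

/-- The `L`-structure `N` extended by further elements, pulled back along a retraction. -/
@[reducible] def extendStructure (N I : Type u) [L.Structure N] (p : N) : L.Structure (N ⊕ I) where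
  funMap f x := .inl (funMap f (codeRetract p ∘ x))
  RelMap r x := RelMap r (codeRetract p ∘ x)

/-- The coding structure on `N ⊕ I`, for a family `G` of enumerations indexed by `N ⊕ I`. -/
@[reducible] def codeStructure (N I : Type u) (G : N ⊕ I → Λ → N) : (codeLang Λ).Structure (N ⊕ I) where
  funMap {_} f x := match f with
    | CodeFun.F i => .inl (G (x 0) i)
  RelMap {_} r x := match r with
    | CodeRel.P => ∃ y, x 0 = .inl y

/-- A class of models of an infinitary sentence that is invariant under unions of elementary chains
is `Σ` in `L^{1,c}_κ`. -/
theorem isSigma_of_unionInvariant {κ θ : Cardinal.{u}} (hκ : κ.IsStrongLimit) (hθκ : θ < κ)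
    (hθ : ℵ₀ ≤ θ) {φ : InfFormula L PEmpty.{u + 1}}
    (hφ : MemL (Order.succ θ) (Order.succ θ) φ) (hφU : UnionInvariant θ φ) (K : ModelClass L)
    (hK : ∀ (N : Type u) [L.Structure N] [Nonempty N], K N ↔ Realize N φ PEmpty.elim) :
    (L1c κ).IsSigma K := by
  obtain ⟨SF, SR, hF, hR, hS⟩ := exists_support hθ hφ
  -- A power of two with exponent `θ` gives `#Λ ^ θ = #Λ`, as Löwenheim–Skolem requires.
  obtain ⟨Λ, hΛ⟩ : ∃ Λ : Type u, #Λ = 2 ^ θ := ⟨_, mk_out _⟩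
  have hθΛ : θ ≤ #Λ := hΛ ▸ (cantor θ).le
  have hΛθ : #Λ ^ θ ≤ #Λ := by rw [hΛ, ← power_mul, mul_eq_self hθ]
  have hΛ₀ : ℵ₀ ≤ #Λ := hθ.trans hθΛ
  have hA : #(UAtom SF SR (Λ ⊕ Λ)) ≤ #Λ :=
    UAtom.mk_le hΛ₀ (hF.trans hθΛ) (hR.trans hθΛ) (by rw [mk_sum, lift_id, add_eq_self hΛ₀])
  have : Infinite Λ := infinite_iff.2 hΛ₀
  obtain ⟨i₀⟩ : Nonempty Λ := inferInstance
  have hΛκ : #Λ < κ := hΛ ▸ hκ.isStrongPrelimit hθκ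
  -- This bounds the number of sets of atoms, hence the disjunction over good diagrams. It stays
  -- below `κ` by the strong limit property, and König's theorem makes its cofinality uncountable.
  let Θ : Cardinal.{u} := 2 ^ #Λ
  have hΛΘ : #Λ ≤ Θ := (cantor _).le
  have hΘκ : Θ < κ := hκ.isStrongPrelimit hΛκ
  let D : Set (Set (UAtom SF SR (Λ ⊕ Λ))) := {d | GoodDiagram SF SR θ φ i₀ d}
  have hD : #D ≤ Θ := by
    refine (mk_set_le D).trans ?_
    rw [mk_set]
    exact power_le_power_left two_ne_zero hA
  have hcof : ℵ₀ < Θ.ord.cof := hΛ₀.trans_lt (lt_cof_ord_power hΛ₀ (by norm_num))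
  have hKt : ∀ (N : Type u) [L.Structure N] (p : N),
      Realize (Triv SF SR N p) φ PEmpty.elim ↔ Realize N φ PEmpty.elim := fun N i p => by
    refine hS N _ i (fun s hs => ?_) (fun s hs => ?_) PEmpty.elim
    · funext x
      exact if_pos hs
    · funext x
      exact propext (and_iff_right hs)
  refine ⟨codeLang Λ, codeP Λ, ⟨codingSentence D, Θ, hΘκ, hcof, Θ, hΘκ,
    memL1c_codingSentence (hΛ₀.trans hΛΘ) hΛΘ (hA.trans hΛΘ) D hD⟩, fun N _ _ => ?_⟩
  rw [hK]
  constructor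
  · intro hN
    obtain ⟨p⟩ : Nonempty N := inferInstance
    let N' := Triv SF SR N p
    have hT : IsTriv SF SR N' p := isTriv_triv N p
    let I := {v : Λ → N // IsIndex (L := L) (N := N') θ p i₀ v}
    have hI : ∀ X : Set N, #X ≤ #Λ → ∃ v : I, X ⊆ Set.range v.1 := fun X hX => by
      obtain ⟨v, hv, h⟩ := exists_isIndex hθ hθΛ hΛθ hF hR hT i₀ X hX
      exact ⟨⟨v, hv⟩, h⟩
    obtain ⟨v₀, -⟩ := hI ∅ (by simp)
    -- Elements of `N` must code something as well; they all receive the default index `v₀`.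
    let G : N ⊕ I → Λ → N := Sum.elim (fun _ => v₀.1) fun v => v.1
    have hG : ∀ a, IsIndex (L := L) (N := N') θ p i₀ (G a) := by
      rintro (a | v)
      · exact v₀.2
      · exact v.2
    let _ := extendStructure (L := L) N I p
    let _ := codeStructure N I G
    let e : N ↪[L] N ⊕ I :=
      { toFun := Sum.inl
        inj' := Sum.inl_injective
        map_fun' := fun f x => rfl
        map_rel' := fun r x => Iff.rfl }
    have hFG : ∀ (i : Λ) (a : N ⊕ I), funMap (codeF i) ![a] = e (G a i) := fun _ _ => rfl
    have hP : ∀ x : N ⊕ I, RelMap (codeP Λ) ![x] ↔ x ∈ Set.range e := fun x =>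
      ⟨fun ⟨y, hy⟩ => ⟨y, hy.symm⟩, fun ⟨y, hy⟩ => ⟨y, hy.symm⟩⟩
    refine ⟨N ⊕ I, inferInstance, inferInstance, inferInstance, ?_, e, ?_⟩
    · refine (realize_codingSentence D (N ⊕ I)).2 ⟨fun a i => ?_, fun a b => ?_, fun a b => ?_,
        fun x => ?_⟩
      · rw [hP, hFG]
        exact ⟨_, rfl⟩
      · refine ⟨N', inferInstance, p, G a, G b, hT, (hKt N p).2 hN, hG a, hG b, ?_⟩
        ext y
        refine Iff.trans ?_ (UAtom.holds_triv p (Sum.elim (G a) (G b)) y).symm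
        refine Iff.trans ?_ (UAtom.holds_embedding e (Sum.elim (G a) (G b)) y)
        rw [Sum.comp_elim]
        rfl
      · obtain ⟨v, hv⟩ := hI (Set.range (G a) ∪ Set.range (G b)) ((mk_union_le _ _).trans
          (add_le_of_le hΛ₀ mk_range_le mk_range_le))
        refine ⟨.inr v, fun i => ?_, fun i => ?_⟩
        · obtain ⟨j, hj⟩ := hv (.inl ⟨i, rfl⟩)
          exact ⟨j, congrArg e hj.symm⟩
        · obtain ⟨j, hj⟩ := hv (.inr ⟨i, rfl⟩)
          exact ⟨j, congrArg e hj.symm⟩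
      · obtain ⟨v, hv⟩ := hI (Set.range fun i => codeRetract p (x i)) mk_range_le
        -- A single index contains the whole sequence, so a constant partition suffices.
        refine ⟨fun _ => 0, fun n => ⟨.inr v, fun i _ hi => ?_⟩⟩
        obtain ⟨y, hy⟩ := (hP _).1 hi
        obtain ⟨j, hj⟩ := hv ⟨i, rfl⟩
        refine ⟨j, ?_⟩
        rw [hFG, ← hy]
        simp only [← hy] at hj
        exact congrArg e hj.symm
    · ext x
      exact (hP x).symm
  · rintro ⟨M, _, _, hM, hχ, e, he⟩
    obtain ⟨h₁, h₂, h₃, h₄⟩ := (realize_codingSentence D M).1 hχ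
    have hG : ∀ (a : M) (i : Λ), ∃ y, e y = funMap (codeF i) ![a] := fun a i => by
      have : funMap (codeF i) ![a] ∈ {x | RelMap (codeP Λ) ![x]} := h₁ a i
      rwa [← he] at this
    choose G hG using hG
    obtain ⟨a₀⟩ := id hM
    let p := G a₀ i₀
    have hgood : ∀ a b, GoodDiagram SF SR θ φ i₀ {x | x.Holds (Sum.elim (G a) (G b))} :=
      fun a b => by
        have := h₂ a b
        simp only [← hG] at this
        refine (congrArg (GoodDiagram SF SR θ φ i₀) (Set.ext fun x => ?_)).mpr this
        refine (UAtom.holds_embedding e _ _).symm.trans ?_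
        rw [Sum.comp_elim]
        rfl
    -- The equality of the two entries at `i₀` belongs to every good diagram, so all families share
    -- one base point.
    have hp : ∀ a, G a i₀ = p := fun a => by
      obtain ⟨N', _, p', v, w, _, _, hv, hw, hd⟩ := hgood a a₀
      exact (Set.ext_iff.1 hd (.eq (.inl i₀) (.inr i₀))).2 (hv.1.trans hw.1.symm)
    rw [← hKt N p]
    refine realize_of_covering hθ hθΛ hΛθ hφ hφU hF hR (isTriv_triv N p) (I := M) G hp
      (fun a b => ?_) (fun a b => ?_) fun x => ?_
    · exact (congrArg (GoodDiagram SF SR θ φ i₀)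
        (Set.ext fun x => UAtom.holds_triv p (Sum.elim (G a) (G b)) x)).mpr (hgood a b)
    · obtain ⟨c, hc, hc'⟩ := h₃ a b
      refine ⟨c, ?_, ?_⟩
      · rintro _ ⟨i, rfl⟩
        obtain ⟨j, hj⟩ := hc i
        rw [← hG, ← hG] at hj
        exact ⟨j, e.injective hj.symm⟩
      · rintro _ ⟨i, rfl⟩
        obtain ⟨j, hj⟩ := hc' i
        rw [← hG, ← hG] at hj
        exact ⟨j, e.injective hj.symm⟩
    · obtain ⟨f, hf⟩ := h₄ fun i => e (x i)
      choose a ha using hf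
      -- The `n`-th chosen range covers the entries in the fibre of `f` over `n`.
      refine ⟨a, fun i => ⟨f i, ?_⟩⟩
      obtain ⟨j, hj⟩ := ha (f i) i rfl (by
        change _ ∈ {x | RelMap (codeP Λ) ![x]}
        rw [← he]
        exact ⟨_, rfl⟩)
      rw [← hG] at hj
      exact ⟨j, e.injective hj.symm⟩

end

end InfLogic

theorem mainTheorem6 (κ : Cardinal.{u}) (hκ : κ.IsStrongLimit) (hω : Cardinal.aleph0 < κ)
    (𝓛 : InfLogic.AbstractLogic.{u, w})
    (hLkk : 𝓛.IsSublogic (InfLogic.Lkk κ))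
    (hUnion : InfLogic.HasUnionLemma 𝓛 κ)
    (hCov : ∀ μ < κ, 𝓛.Defines (InfLogic.CoveringClass μ)) :
    𝓛.IsSublogic (InfLogic.L1c κ).Delta := by
  intro L ψ
  rw [InfLogic.AbstractLogic.delta_defines_iff]
  obtain ⟨⟨φ, θ₁, hθ₁, hφ⟩, hψ⟩ := hLkk L ψ
  replace hψ : ∀ (M : Type u) [L.Structure M] [Nonempty M],
      𝓛.Sat ψ M ↔ InfLogic.InfFormula.Realize M φ PEmpty.elim := fun M _ _ => (hψ M).symm
  obtain ⟨θ₂, hθ₂, hU⟩ := hUnion L ψ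
  -- Enlarging `θ` keeps `φ` in `L_{θ⁺θ⁺}` and preserves the Union Lemma, since elementarity of
  -- chains becomes a stronger assumption.
  let θ := max ℵ₀ (max θ₁ θ₂)
  have h₁ : θ₁ ≤ θ := (le_max_left _ _).trans (le_max_right _ _)
  have h₂ : θ₂ ≤ θ := (le_max_right _ _).trans (le_max_right _ _)
  have hθκ : θ < κ := max_lt hω (max_lt hθ₁ hθ₂)
  have hθ : ℵ₀ ≤ θ := le_max_left _ _
  have hφ' := hφ.mono (Order.succ_le_succ h₁) (Order.succ_le_succ h₁)
  have hφU : InfLogic.UnionInvariant θ φ := by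
    intro M _ _ S _ hS hx hel n
    rw [← hψ, ← hψ]
    exact hU M S hS hx (fun n => (hel n).mono h₂) n
  exact ⟨InfLogic.isSigma_of_unionInvariant hκ hθκ hθ hφ' hφU _ hψ,
    InfLogic.isSigma_of_unionInvariant hκ hθκ hθ hφ'.neg hφU.neg _ fun N _ _ =>
      not_congr (hψ N)⟩
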